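/- Let $\hbar\in\mathbb R$, $q=e^{i\hbar/2}$, $\omega=q^2=e^{i\hbar}$. Let $\mathfrak A=\mathbb C\langle u_n : n\in\mathbb Z\rangle$ be the free associative algebra, $\mathcal S$ its automorphism $u_n\mapsto u_{n+1}$, and let $\mathfrak A_{\mathfrak I_a}$ be the quotient of $\mathfrak A$ by the relations $u_nu_{n+1}=\omega u_{n+1}u_n$ and $u_nu_m=u_mu_n$ for $|n-m|\ge 2$. It has the basis of normally ordered monomials $\cdots u_1^{a_1}u_0^{a_0}u_{-1}^{a_{-1}}\cdots$, and its multiplication extends to arbitrary infinite linear combinations of these monomials (every monomial splits into two factors in only finitely many ways); infinite sums, their products and commutators are understood in this algebra of formal series. The Hermitian conjugation $\dagger$ is the conjugate-linear anti-automorphism with $u_n^\dagger=u_n$. For $\alpha\in\mathbb Z^\ell$ write $u_\alpha=u_{\alpha_1}\cdots u_{\alpha_\ell}$, $\alpha+k=(\alpha_1+k,\dots,\alpha_\ell+k)$, and let $\nu(\alpha,i)$ be the number of entries of $\alpha$ equal to $i$; $\alpha\sim\beta$ means $\nu(\alpha,i)=\nu(\beta,i)$ for all $i$. For $\ell\ge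 1$ let $$\mathcal A^\ell=\{\alpha\in\mathbb Z^\ell : 1-j\le\alpha_j\le \ell-j\ (1\le j\le \ell),\ \alpha_{j}\le\alpha_{j+1}+1\ (1\le j<\ell)\},\qquad X^{(\ell)}=\sum_{\alpha\in\mathcal A^\ell}u_\alpha ,$$ $$\mathcal N^\ell=\{\alpha\in\mathcal A^\ell : \alpha_{j+1}\le\alpha_j\le\alpha_{j+1}+1\ (1\le j<\ell),\ \alpha_\ell=0\}.$$ The quantised Volterra hierarchy consists of the derivations $\partial_{t_\ell}$, $\ell\ge1$, of $\mathfrak A$ with $$\partial_{t_\ell}(u_n)=q^\ell\,\mathcal S^n\bigl(\mathcal S(X^{(\ell)})u_0-u_0\mathcal S^{-1}(X^{(\ell)})\bigr),\qquad n\in\mathbb Z .$$ For $\alpha\in\mathcal N^\ell$ let $P_\alpha\in\mathbb Z[\omega]$ ($\omega$ an indeterminate) be the polynomial for which $\sum_{\beta\in\mathcal A^\ell,\ \beta\sim\alpha}u_\beta=P_\alpha(\omega)u_\alpha$ follows from the relations above. **Theorem.** (a) For $\ell\ge1$ and $\alpha\in\mathcal N^\ell$, $$P_\alpha(\omega)=\prod_{0\le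 i<\alpha_1}\binom{\nu(\alpha,i+1)+\nu(\alpha,i)-1}{\nu(\alpha,i+1)}_{\omega}\qquad\text{with}\qquad \binom{m}{r}_{\omega}=\prod_{s=1}^{r}\frac{1-\omega^{m-s+1}}{1-\omega^{s}},$$ and $P_\alpha(\omega)\frac{\omega^\ell-1}{\omega^{\nu(\alpha,0)}-1}$ is a polynomial in $\omega$ with integer coefficients. Therefore, for every $\hbar\in\mathbb R$, the formal series $$H_\ell=\sum_{\alpha\in\mathcal N^\ell}\sum_{k\in\mathbb Z}P_\alpha(\omega)\,\frac{\omega^\ell-1}{\omega^{\nu(\alpha,0)}-1}\,u_{\alpha+k},\qquad \omega=e^{i\hbar},$$ is defined, the fraction denoting the value of this polynomial. (b) If $\ell\ge1$ and $\sin(\ell\hbar/2)\ne0$, then in $\mathfrak A_{\mathfrak I_a}$ the hierarchy has the Heisenberg form $$\partial_{t_\ell}(u_n)=\frac{i}{2\sin(\frac12\ell\hbar)}\,[H_\ell,u_n]\qquad(n\in\mathbb Z),$$ and likewise with any $a\in\mathfrak A$ in place of $u_n$ (in particular $\partial_{t_\ell}$ descends to a derivation of $\mathfrak A_{\mathfrak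 I_a}$). (c) $H_\ell^\dagger=H_\ell$ for all $\ell\ge1$. (d) $[H_\ell,H_m]=0$ for all $\ell,m\ge1$. -/

import Mathlib

open Polynomial

noncomputable section

namespace Volterra

/-! ### The free difference algebra and the nonabelian Volterra hierarchy -/

section Free

variable {R : Type*} [CommRing R]

/-- The generator `u_n` of the free associative algebra `R⟨u_n ; n ∈ ℤ⟩`. -/
def u (R : Type*) [CommRing R] (n : ℤ) : FreeAlgebra R ℤ := FreeAlgebra.ι R n

/-- The word `u_{α_1} u_{α_2} ⋯ u_{α_k}` attached to `α ∈ ℤ^k` (the factors in this order). -/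
def word (R : Type*) [CommRing R] {k : ℕ} (α : Fin k → ℤ) : FreeAlgebra R ℤ :=
  (List.ofFn fun j => u R (α j)).prod

/-- The power `S^n` of the shift automorphism, `S^n u_m = u_{m+n}`. -/
def shift (n : ℤ) : FreeAlgebra R ℤ →ₐ[R] FreeAlgebra R ℤ :=
  FreeAlgebra.lift R fun m => u R (m + n)

/-- The algebra homomorphism `a ↦ a + ε D(a)` with `D(u_n) = S^n(a₀)` and `ε² = 0`. -/
def evolHom (a₀ : FreeAlgebra R ℤ) :
    FreeAlgebra R ℤ →ₐ[R] TrivSqZeroExt (FreeAlgebra R ℤ) (FreeAlgebra R ℤ) :=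
  FreeAlgebra.lift R fun n => TrivSqZeroExt.inl (u R n) + TrivSqZeroExt.inr (shift n a₀)

/-- The evolutionary derivation `D` with characteristic `a₀`: the unique `R`-linear derivation
of the free algebra with `D(u_n) = S^n(a₀)` for all `n`. -/
def evolDer (a₀ : FreeAlgebra R ℤ) : FreeAlgebra R ℤ →ₗ[R] FreeAlgebra R ℤ where
  toFun a := (evolHom a₀ a).snd
  map_add' a b := by simp
  map_smul' c a := by simp

theorem evolHom_fst (a₀ a : FreeAlgebra R ℤ) : (evolHom a₀ a).fst = a := by
  have h : (TrivSqZeroExt.fstHom R (FreeAlgebra R ℤ) (FreeAlgebra R ℤ)).comp (evolHom a₀)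
      = AlgHom.id R _ := by
    apply FreeAlgebra.hom_ext
    funext n
    simp [evolHom, u]
  exact congrArg (fun f => f a) h

theorem evolDer_u (a₀ : FreeAlgebra R ℤ) (n : ℤ) : evolDer a₀ (u R n) = shift n a₀ := by
  simp [evolDer, evolHom, u]

theorem evolDer_mul (a₀ a b : FreeAlgebra R ℤ) :
    evolDer a₀ (a * b) = evolDer a₀ a * b + a * evolDer a₀ b := by
  simp only [evolDer, LinearMap.coe_mk, AddHom.coe_mk, map_mul, TrivSqZeroExt.snd_mul,
    evolHom_fst]
  simp [add_comm]

/-- The admissible multi-indices: `1 - j ≤ α_j ≤ k - j` for `j = 1, …, k` and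
`α_{j+1} + 1 ≥ α_j` (positions are counted from `0` here). -/
def admissible (k : ℕ) : Finset (Fin k → ℤ) :=
  (Fintype.piFinset fun j : Fin k => Finset.Icc (-(j : ℤ)) ((k : ℤ) - 1 - (j : ℤ))).filter
    fun α => ∀ i j : Fin k, (i : ℕ) + 1 = (j : ℕ) → α i ≤ α j + 1

/-- The noncommutative polynomial `X^{(ℓ)}`, the sum of all admissible words of length `ℓ`. -/
def Xpoly (R : Type*) [CommRing R] (ℓ : ℕ) : FreeAlgebra R ℤ :=
  ∑ α ∈ admissible ℓ, word R α

/-- The derivation `∂_{t_ℓ}` of the rescaled hierarchy, with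
`∂_{t_ℓ}(u_n) = q^ℓ S^n (S(X^{(ℓ)}) u_0 - u_0 S^{-1}(X^{(ℓ)}))`. -/
def volterraFlow (q : R) (ℓ : ℕ) : FreeAlgebra R ℤ →ₗ[R] FreeAlgebra R ℤ :=
  evolDer (q ^ ℓ • (shift 1 (Xpoly R ℓ) * u R 0 - u R 0 * shift (-1) (Xpoly R ℓ)))

end Free

/-! ### The quantum algebra -/

section Quantum

variable {R : Type*} [CommRing R]

/-- The defining relations `u_n u_{n+1} = ω u_{n+1} u_n`, and `u_n u_m = u_m u_n` for
`|n - m| ≥ 2`. -/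
inductive QRel (ω : R) : FreeAlgebra R ℤ → FreeAlgebra R ℤ → Prop
  | adj (n : ℤ) : QRel ω (u R n * u R (n + 1)) (ω • (u R (n + 1) * u R n))
  | comm (n m : ℤ) (h : 2 ≤ |n - m|) : QRel ω (u R n * u R m) (u R m * u R n)

/-- The quantum algebra: the quotient of the free algebra by the two-sided ideal generated by
the relations above. -/
abbrev QAlg (ω : R) : Type _ := RingQuot (QRel ω)

/-- The canonical projection of the free algebra onto the quantum algebra. -/
def proj (ω : R) : FreeAlgebra R ℤ →ₐ[R] QAlg ω := RingQuot.mkAlgHom R (QRel ω)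

/-! ### Formal series of normally ordered monomials

For `a : ℤ →₀ ℕ` let `u^a` be the normally ordered monomial `⋯ u_2^{a_2} u_1^{a_1} u_0^{a_0} ⋯`.
The product is `u^a u^b = ω^{c(a,b)} u^{a+b}` with `c(a,b) = ∑ a_n b_{n+1}`, and it extends to
arbitrary (infinite) linear combinations because every exponent is a sum of two exponents in
only finitely many ways. -/

/-- The exponent `c(a,b) = ∑ a_n b_{n+1}` of `ω` in `u^a u^b = ω^{c(a,b)} u^{a+b}`. -/
def cocycle (a b : ℤ →₀ ℕ) : ℕ := a.sum fun n x => x * b (n + 1)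

theorem cocycle_add_left (a b c : ℤ →₀ ℕ) :
    cocycle (a + b) c = cocycle a c + cocycle b c := by
  unfold cocycle
  exact Finsupp.sum_add_index' (fun _ => by simp) (fun _ _ _ => by ring)

theorem cocycle_add_right (a b c : ℤ →₀ ℕ) :
    cocycle a (b + c) = cocycle a b + cocycle a c := by
  unfold cocycle
  rw [← Finsupp.sum_add]
  refine Finsupp.sum_congr fun _ _ => ?_
  simp [mul_add]

@[simp] theorem cocycle_zero_left (a : ℤ →₀ ℕ) : cocycle 0 a = 0 := by simp [cocycle]

@[simp] theorem cocycle_zero_right (a : ℤ →₀ ℕ) : cocycle a 0 = 0 := by simp [cocycle]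

theorem cocycle_single_left (n : ℤ) (x : ℕ) (b : ℤ →₀ ℕ) :
    cocycle (Finsupp.single n x) b = x * b (n + 1) := by
  simp [cocycle]

/-- Formal, possibly infinite, linear combinations `∑ f(a) u^a` of normally ordered monomials. -/
@[ext] structure QSeries (ω : R) where
  /-- the coefficient of the normally ordered monomial with a given exponent -/
  coeff : (ℤ →₀ ℕ) → R

namespace QSeries

variable {ω : R}

instance : Zero (QSeries ω) := ⟨⟨fun _ => 0⟩⟩
instance : Add (QSeries ω) := ⟨fun f g => ⟨fun a => f.coeff a + g.coeff a⟩⟩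
instance : Neg (QSeries ω) := ⟨fun f => ⟨fun a => -f.coeff a⟩⟩
instance : Sub (QSeries ω) := ⟨fun f g => ⟨fun a => f.coeff a - g.coeff a⟩⟩
instance : SMul R (QSeries ω) := ⟨fun r f => ⟨fun a => r * f.coeff a⟩⟩

/-- The series `r u^a`. -/
def single (a : ℤ →₀ ℕ) (r : R) : QSeries ω :=
  ⟨fun b => open Classical in if b = a then r else 0⟩

instance : One (QSeries ω) := ⟨single 0 1⟩

/-- The product determined by `u^a u^b = ω^{c(a,b)} u^{a+b}`. -/
instance : Mul (QSeries ω) :=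
  ⟨fun f g => ⟨fun a => ∑ p ∈ Finset.HasAntidiagonal.antidiagonal a,
    ω ^ cocycle p.1 p.2 * (f.coeff p.1 * g.coeff p.2)⟩⟩

@[simp] theorem coeff_zero (a : ℤ →₀ ℕ) : (0 : QSeries ω).coeff a = 0 := rfl
@[simp] theorem coeff_add (f g : QSeries ω) (a : ℤ →₀ ℕ) :
    (f + g).coeff a = f.coeff a + g.coeff a := rfl
@[simp] theorem coeff_neg (f : QSeries ω) (a : ℤ →₀ ℕ) : (-f).coeff a = -f.coeff a := rfl
@[simp] theorem coeff_sub (f g : QSeries ω) (a : ℤ →₀ ℕ) :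
    (f - g).coeff a = f.coeff a - g.coeff a := rfl
@[simp] theorem coeff_smul (r : R) (f : QSeries ω) (a : ℤ →₀ ℕ) :
    (r • f).coeff a = r * f.coeff a := rfl
theorem coeff_single (a b : ℤ →₀ ℕ) (r : R) :
    (single a r : QSeries ω).coeff b = open Classical in if b = a then r else 0 := rfl
theorem coeff_one (a : ℤ →₀ ℕ) :
    (1 : QSeries ω).coeff a = open Classical in if a = 0 then 1 else 0 := rfl
theorem coeff_mul (f g : QSeries ω) (a : ℤ →₀ ℕ) :
    (f * g).coeff a = ∑ p ∈ Finset.HasAntidiagonal.antidiagonal a,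
      ω ^ cocycle p.1 p.2 * (f.coeff p.1 * g.coeff p.2) := rfl

theorem single_mul_single (a b : ℤ →₀ ℕ) (r s : R) :
    (single a r * single b s : QSeries ω) = single (a + b) (ω ^ cocycle a b * (r * s)) := by
  classical
  ext c
  rw [coeff_mul, coeff_single]
  simp only [coeff_single]
  split_ifs with h
  · rw [Finset.sum_eq_single (a, b)]
    · simp
    · rintro ⟨x, y⟩ - hxy
      by_cases hx : x = a
      · have hy : y ≠ b := fun hy => hxy (by rw [hx, hy])
        simp [hy]
      · simp [hx]
    · intro hn
      exact absurd (Finset.HasAntidiagonal.mem_antidiagonal.2 h.symm) hn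
  · refine Finset.sum_eq_zero ?_
    rintro ⟨x, y⟩ hxy
    rw [Finset.HasAntidiagonal.mem_antidiagonal] at hxy
    by_cases hx : x = a
    · have hy : y ≠ b := fun hy => h (by rw [← hxy, hx, hy])
      simp [hy]
    · simp [hx]

protected theorem mul_assoc (f g h : QSeries ω) : f * g * h = f * (g * h) := by
  ext a
  simp only [coeff_mul, Finset.sum_mul, Finset.mul_sum, Finset.sum_sigma']
  refine Finset.sum_nbij' (fun x => ⟨(x.2.1, x.2.2 + x.1.2), (x.2.2, x.1.2)⟩)
    (fun x => ⟨(x.1.1 + x.2.1, x.2.2), (x.1.1, x.2.1)⟩) ?_ ?_ ?_ ?_ ?_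
  · rintro ⟨⟨i, j⟩, ⟨k, l⟩⟩ hx
    simp only [Finset.mem_sigma, Finset.HasAntidiagonal.mem_antidiagonal] at hx ⊢
    exact ⟨by rw [← add_assoc, hx.2, hx.1], trivial⟩
  · rintro ⟨⟨i, j⟩, ⟨k, l⟩⟩ hx
    simp only [Finset.mem_sigma, Finset.HasAntidiagonal.mem_antidiagonal] at hx ⊢
    exact ⟨by rw [add_assoc, hx.2, hx.1], trivial⟩
  · rintro ⟨⟨i, j⟩, ⟨k, l⟩⟩ hx
    simp only [Finset.mem_sigma, Finset.HasAntidiagonal.mem_antidiagonal] at hx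
    obtain ⟨-, rfl⟩ := hx
    rfl
  · rintro ⟨⟨i, j⟩, ⟨k, l⟩⟩ hx
    simp only [Finset.mem_sigma, Finset.HasAntidiagonal.mem_antidiagonal] at hx
    obtain ⟨-, rfl⟩ := hx
    rfl
  · rintro ⟨⟨i, j⟩, ⟨k, l⟩⟩ hx
    simp only [Finset.mem_sigma, Finset.HasAntidiagonal.mem_antidiagonal] at hx
    obtain ⟨-, rfl⟩ := hx
    simp only [cocycle_add_left, cocycle_add_right, pow_add]
    ring

protected theorem one_mul (f : QSeries ω) : 1 * f = f := by
  classical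
  ext a
  rw [coeff_mul, Finset.sum_eq_single (0, a)]
  · simp [coeff_one]
  · rintro ⟨x, y⟩ hxy hne
    rw [Finset.HasAntidiagonal.mem_antidiagonal] at hxy
    have hx : x ≠ 0 := by
      rintro rfl
      exact hne (by simpa using hxy)
    simp [coeff_one, hx]
  · intro h
    simp at h

protected theorem mul_one (f : QSeries ω) : f * 1 = f := by
  classical
  ext a
  rw [coeff_mul, Finset.sum_eq_single (a, 0)]
  · simp [coeff_one]
  · rintro ⟨x, y⟩ hxy hne
    rw [Finset.HasAntidiagonal.mem_antidiagonal] at hxy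
    have hy : y ≠ 0 := by
      rintro rfl
      exact hne (by simpa using hxy)
    simp [coeff_one, hy]
  · intro h
    simp at h

instance : Ring (QSeries ω) where
  add_assoc f g h := by ext; simp [add_assoc]
  zero_add f := by ext; simp
  add_zero f := by ext; simp
  add_comm f g := by ext; simp [add_comm]
  neg_add_cancel f := by ext; simp
  sub_eq_add_neg f g := by ext; simp [sub_eq_add_neg]
  nsmul := nsmulRec
  zsmul := zsmulRec
  left_distrib f g h := by ext; simp [coeff_mul, mul_add, Finset.sum_add_distrib]
  right_distrib f g h := by ext; simp [coeff_mul, mul_add, add_mul, Finset.sum_add_distrib]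
  zero_mul f := by ext; simp [coeff_mul]
  mul_zero f := by ext; simp [coeff_mul]
  mul_assoc := QSeries.mul_assoc
  one_mul := QSeries.one_mul
  mul_one := QSeries.mul_one

instance : Module R (QSeries ω) where
  one_smul f := by ext; simp
  mul_smul r s f := by ext; simp [mul_assoc]
  smul_zero r := by ext; simp
  smul_add r f g := by ext; simp [mul_add]
  add_smul r s f := by ext; simp [add_mul]
  zero_smul f := by ext; simp

instance : Algebra R (QSeries ω) :=
  Algebra.ofModule
    (fun r f g => by
      ext
      simp only [coeff_mul, coeff_smul, Finset.mul_sum]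
      exact Finset.sum_congr rfl fun _ _ => by ring)
    (fun r f g => by
      ext
      simp only [coeff_mul, coeff_smul, Finset.mul_sum]
      exact Finset.sum_congr rfl fun _ _ => by ring)

/-- The sum of a family of series, taken coefficient by coefficient. It is used for families in
which every monomial occurs only finitely often. -/
def formalSum {ι : Type*} (f : ι → QSeries ω) : QSeries ω :=
  ⟨fun a => ∑ᶠ i, (f i).coeff a⟩

end QSeries

/-! ### The quantum algebra inside the formal series -/

/-- The homomorphism of the free algebra to formal series with `u_n ↦ u^{e_n}`. -/
def freeToSeries (ω : R) : FreeAlgebra R ℤ →ₐ[R] QSeries ω :=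
  FreeAlgebra.lift R fun n => QSeries.single (Finsupp.single n 1) 1

theorem freeToSeries_u (ω : R) (n : ℤ) :
    freeToSeries ω (u R n) = QSeries.single (Finsupp.single n 1) 1 := by
  simp [freeToSeries, u]

theorem freeToSeries_rel (ω : R) ⦃x y : FreeAlgebra R ℤ⦄ (h : QRel ω x y) :
    freeToSeries ω x = freeToSeries ω y := by
  cases h with
  | adj n =>
    simp only [map_mul, map_smul, freeToSeries_u, QSeries.single_mul_single,
      cocycle_single_left]
    ext a
    have h1 : n ≠ n + 1 + 1 := by omega
    simp [QSeries.coeff_single, h1,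
      add_comm (Finsupp.single (n + 1) 1) (Finsupp.single n 1)]
  | comm n m h =>
    have h1 : m ≠ n + 1 := by rintro rfl; simp at h
    have h2 : n ≠ m + 1 := by rintro rfl; simp at h
    simp only [map_mul, freeToSeries_u, QSeries.single_mul_single, cocycle_single_left]
    ext a
    simp [QSeries.coeff_single, h1, h2,
      add_comm (Finsupp.single m 1) (Finsupp.single n 1)]

/-- The expansion of an element of the quantum algebra in normally ordered monomials. -/
def toSeries (ω : R) : QAlg ω →ₐ[R] QSeries ω :=
  RingQuot.liftAlgHom R ⟨freeToSeries ω, freeToSeries_rel ω⟩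

theorem toSeries_proj (ω : R) (a : FreeAlgebra R ℤ) :
    toSeries ω (proj ω a) = freeToSeries ω a := by
  simp [toSeries, proj]


/-- The exponent (multiplicity function) of a list of letters. -/
def listWt (L : List ℤ) : ℤ →₀ ℕ := Multiset.toFinsupp (L : Multiset ℤ)

/-- The multiplicities `i ↦ ν(α,i)` of a multi-index. Two multi-indices are similar if their
multiplicities agree. -/
def wt {k : ℕ} (α : Fin k → ℤ) : ℤ →₀ ℕ := ∑ j, Finsupp.single (α j) 1

theorem listWt_cons (n : ℤ) (L : List ℤ) :
    listWt (n :: L) = Finsupp.single n 1 + listWt L := by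
  simp only [listWt]
  rw [← Multiset.cons_coe, ← Multiset.singleton_add, map_add, Multiset.toFinsupp_singleton]

theorem listWt_ofFn {k : ℕ} (α : Fin k → ℤ) : listWt (List.ofFn α) = wt α := by
  induction k with
  | zero => simp [listWt, wt]
  | succ k ih =>
    rw [List.ofFn_succ, listWt_cons, ih, wt, wt, Fin.sum_univ_succ]

theorem freeToSeries_list (ω : R) (L : List ℤ) :
    ∃ c : ℕ, freeToSeries ω (L.map (u R)).prod = QSeries.single (listWt L) (ω ^ c) := by
  induction L with
  | nil => exact ⟨0, by simp [listWt]; rfl⟩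
  | cons n L ih =>
    obtain ⟨c, hc⟩ := ih
    refine ⟨cocycle (Finsupp.single n 1) (listWt L) + c, ?_⟩
    rw [List.map_cons, List.prod_cons, map_mul, hc, freeToSeries_u, QSeries.single_mul_single,
      listWt_cons, one_mul, pow_add]

theorem freeToSeries_sorted (ω : R) (L : List ℤ) (hL : L.Pairwise (· ≥ ·)) :
    freeToSeries ω (L.map (u R)).prod = QSeries.single (listWt L) 1 := by
  induction L with
  | nil => simp [listWt]; rfl
  | cons n L ih =>
    rw [List.pairwise_cons] at hL
    have h0 : listWt L (n + 1) = 0 := by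
      simp only [listWt, Multiset.toFinsupp_apply, Multiset.coe_count]
      rw [List.count_eq_zero]
      intro h
      have := hL.1 _ h
      omega
    rw [List.map_cons, List.prod_cons, map_mul, ih hL.2, freeToSeries_u,
      QSeries.single_mul_single, listWt_cons, cocycle_single_left, h0]
    simp

theorem proj_swap (ω : R) (n m : ℤ) (h : n < m) :
    ∃ c : R, proj ω (u R n) * proj ω (u R m) = c • (proj ω (u R m) * proj ω (u R n)) := by
  by_cases h1 : m = n + 1
  · subst h1
    refine ⟨ω, ?_⟩
    rw [← map_mul, ← map_mul, ← map_smul]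
    exact RingQuot.mkAlgHom_rel R (QRel.adj n)
  · refine ⟨1, ?_⟩
    rw [one_smul, ← map_mul, ← map_mul]
    refine RingQuot.mkAlgHom_rel R (QRel.comm n m ?_)
    rw [abs_sub_comm, abs_of_pos] <;> omega

theorem proj_insert (ω : R) (n : ℤ) (L : List ℤ) :
    ∃ c : R, proj ω (u R n) * proj ω (L.map (u R)).prod
      = c • proj ω ((L.orderedInsert (· ≥ ·) n).map (u R)).prod := by
  induction L with
  | nil => exact ⟨1, by simp⟩
  | cons m L ih =>
    by_cases h : n ≥ m
    · exact ⟨1, by simp [List.orderedInsert, h]⟩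
    · obtain ⟨c, hc⟩ := ih
      obtain ⟨d, hd⟩ := proj_swap ω n m (not_le.1 h)
      refine ⟨d * c, ?_⟩
      simp only [List.orderedInsert, h, if_false, List.map_cons, List.prod_cons, map_mul]
      rw [← mul_assoc, hd, smul_mul_assoc, mul_assoc, hc, mul_smul_comm, smul_smul]

/-- The normally ordered monomial `u^a` in the quantum algebra. -/
def normalMonomial (ω : R) (a : ℤ →₀ ℕ) : QAlg ω :=
  proj ω (((Finsupp.toMultiset a).sort (· ≥ ·)).map (u R)).prod

theorem toSeries_normalMonomial (ω : R) (a : ℤ →₀ ℕ) :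
    toSeries ω (normalMonomial ω a) = QSeries.single a 1 := by
  rw [normalMonomial, toSeries_proj, freeToSeries_sorted _ _ (Multiset.pairwise_sort _ _)]
  simp [listWt]

theorem span_normalMonomial (ω : R) :
    Submodule.span R (Set.range (normalMonomial ω)) = ⊤ := by
  rw [eq_top_iff]
  rintro x -
  obtain ⟨y, rfl⟩ := RingQuot.mkAlgHom_surjective R (QRel ω) x
  change proj ω y ∈ _
  suffices h : ∀ z ∈ Submodule.span R (Set.range (normalMonomial ω)),
      proj ω y * z ∈ Submodule.span R (Set.range (normalMonomial ω)) by
    have h1 : (1 : QAlg ω) ∈ Submodule.span R (Set.range (normalMonomial ω)) :=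
      Submodule.subset_span ⟨0, by simp [normalMonomial]⟩
    simpa using h 1 h1
  induction y using FreeAlgebra.induction with
  | grade0 r =>
    intro z hz
    rw [AlgHom.commutes, ← Algebra.smul_def]
    exact Submodule.smul_mem _ _ hz
  | grade1 n =>
    intro z hz
    induction hz using Submodule.span_induction with
    | mem z hz =>
      obtain ⟨a, rfl⟩ := hz
      obtain ⟨c, hc⟩ := proj_insert ω n ((Finsupp.toMultiset a).sort (· ≥ ·))
      change proj ω (u R n) * _ ∈ _
      rw [normalMonomial, hc]
      refine Submodule.smul_mem _ _ (Submodule.subset_span ⟨a + Finsupp.single n 1, ?_⟩)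
      rw [normalMonomial]
      congr 3
      refine List.Perm.eq_of_pairwise (le := (· ≥ ·)) (fun _ _ _ _ h1 h2 => le_antisymm h2 h1)
        (Multiset.pairwise_sort _ _)
        (List.Pairwise.orderedInsert n _ (Multiset.pairwise_sort _ _)) ?_
      refine List.Perm.trans ?_ (List.perm_orderedInsert _ _ _).symm
      rw [← Multiset.coe_eq_coe, ← Multiset.cons_coe]
      simp [add_comm]
    | zero => simp
    | add x y _ _ hx hy => rw [mul_add]; exact Submodule.add_mem _ hx hy
    | smul r x _ hx => rw [mul_smul_comm]; exact Submodule.smul_mem _ _ hx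
  | mul a b ha hb =>
    intro z hz
    rw [map_mul, mul_assoc]
    exact ha _ (hb _ hz)
  | add a b ha hb =>
    intro z hz
    rw [map_add, add_mul]
    exact Submodule.add_mem _ (ha _ hz) (hb _ hz)

/-- The normally ordered monomials form a basis, so an identity in the quantum algebra may be
checked on the series expansions. -/
theorem toSeries_injective (ω : R) : Function.Injective (toSeries ω) := by
  rw [injective_iff_map_eq_zero]
  intro x hx
  have hmem : x ∈ Submodule.span R (Set.range (normalMonomial ω)) := by
    rw [span_normalMonomial]; trivial
  obtain ⟨c, rfl⟩ := (Finsupp.mem_span_range_iff_exists_finsupp).1 hmem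
  have hc : c = 0 := by
    ext a
    let ev : QSeries ω →ₗ[R] R :=
      { toFun := fun f => f.coeff a, map_add' := fun _ _ => rfl, map_smul' := fun _ _ => rfl }
    have h := congrArg ev hx
    rw [Finsupp.sum, map_sum, map_sum, map_zero] at h
    simp only [map_smul, toSeries_normalMonomial] at h
    rw [Finset.sum_eq_single a] at h
    · simpa [ev, QSeries.coeff_single] using h
    · intro b _ hb
      simp [ev, QSeries.coeff_single, hb.symm]
    · intro ha
      simp [Finsupp.notMem_support_iff.1 ha]
  simp [hc]

end Quantum

/-! ### The polynomials `P_α` -/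

/-- The nonincreasing multi-indices: `α_{j+1} + 1 ≥ α_j ≥ α_{j+1}`. -/
def Nonincreasing {k : ℕ} (α : Fin k → ℤ) : Prop :=
  ∀ i j : Fin k, (i : ℕ) + 1 = (j : ℕ) → α j ≤ α i ∧ α i ≤ α j + 1

/-- The set `N^k` of admissible nonincreasing multi-indices whose last entry is `0`. -/
def indexSet (k : ℕ) : Finset (Fin k → ℤ) :=
  open Classical in (admissible k).filter
    fun α => Nonincreasing α ∧ ∀ j : Fin k, (j : ℕ) + 1 = k → α j = 0

/-- The sum of all admissible words similar to `α`. -/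
def similarSum (R : Type*) [CommRing R] {k : ℕ} (α : Fin k → ℤ) : FreeAlgebra R ℤ :=
  ∑ β ∈ (admissible k).filter (fun β => wt β = wt α), word R β

/-- The polynomial `P_α ∈ ℤ[ω]`: in the quantum algebra over `ℤ[ω]`, with `ω` the
indeterminate, the sum of all admissible words similar to `α` is a multiple of one normally
ordered monomial, and `P_α` is the coefficient. -/
def P {k : ℕ} (α : Fin k → ℤ) : ℤ[X] :=
  (toSeries (X : ℤ[X]) (proj X (similarSum ℤ[X] α))).coeff (wt α)

theorem word_eq {R : Type*} [CommRing R] {k : ℕ} (α : Fin k → ℤ) :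
    word R α = ((List.ofFn α).map (u R)).prod := by
  rw [word, List.map_ofFn]
  rfl

theorem Nonincreasing.pairwise {k : ℕ} {α : Fin k → ℤ} (h : Nonincreasing α) :
    (List.ofFn α).Pairwise (· ≥ ·) := by
  rw [List.pairwise_ofFn]
  have key : ∀ d : ℕ, ∀ i j : Fin k, (i : ℕ) + d = j → α j ≤ α i := by
    intro d
    induction d with
    | zero =>
      intro i j hij
      have : i = j := Fin.ext (by simpa using hij)
      rw [this]
    | succ d ih =>
      intro i j hij
      have hd : (i : ℕ) + d < k := by have := j.2; omega
      exact (h ⟨i + d, hd⟩ j (by simp only; omega)).1.trans (ih i ⟨i + d, hd⟩ rfl)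
  intro i j hij
  exact key (j - i) i j (by have : (i : ℕ) < j := hij; omega)

/-- The defining property of `P_α` for a nonincreasing `α`. -/
theorem proj_similarSum {k : ℕ} {α : Fin k → ℤ} (hα : Nonincreasing α) :
    proj (X : ℤ[X]) (similarSum ℤ[X] α) = P α • proj X (word ℤ[X] α) := by
  classical
  apply toSeries_injective
  rw [map_smul, toSeries_proj X (word _ _), word_eq, freeToSeries_sorted _ _ hα.pairwise,
    listWt_ofFn]
  ext b : 2
  by_cases hb : b = wt α
  · subst hb
    simp [P, QSeries.coeff_single]
  · let ev : QSeries (X : ℤ[X]) →ₗ[ℤ[X]] ℤ[X] :=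
      { toFun := fun f => f.coeff b, map_add' := fun _ _ => rfl, map_smul' := fun _ _ => rfl }
    change ev (toSeries X (proj X (similarSum ℤ[X] α)))
      = ev (P α • (QSeries.single (wt α) 1 : QSeries (X : ℤ[X])))
    rw [toSeries_proj, similarSum, map_sum, map_sum, Finset.sum_eq_zero]
    · simp [ev, QSeries.coeff_single, hb]
    · intro β hβ
      obtain ⟨c, hc⟩ := freeToSeries_list (X : ℤ[X]) (List.ofFn β)
      rw [word_eq, hc, listWt_ofFn, (Finset.mem_filter.1 hβ).2]
      simp [ev, QSeries.coeff_single, hb]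

/-- The Gaussian binomial coefficient
`(1-ω^m)(1-ω^{m-1})⋯(1-ω^{m-r+1}) / ((1-ω)(1-ω^2)⋯(1-ω^r))` as a polynomial in `ω`
(the division is exact). -/
def gaussBinom (m r : ℕ) : ℤ[X] :=
  (∏ i ∈ Finset.range r, (X ^ (m - i) - 1)) /ₘ ∏ i ∈ Finset.range r, (X ^ (i + 1) - 1)

/-! ### The Hamiltonians and the Hermitian conjugation -/

/-- The coefficient `P_α(ω) (ω^ℓ - 1) / (ω^{ν(α,0)} - 1)` as a polynomial in `ω`, the quotient of
`P_α(ω) (ω^ℓ - 1)` by the monic polynomial `ω^{ν(α,0)} - 1`. -/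
def hamCoeff {ℓ : ℕ} (α : Fin ℓ → ℤ) : ℤ[X] :=
  (P α * (X ^ ℓ - 1)) /ₘ (X ^ (wt α 0) - 1)

/-- The Hamiltonian `H_ℓ = ∑_{α ∈ N^ℓ} ∑_{k ∈ ℤ} P_α(ω) (ω^ℓ - 1) / (ω^{ν(α,0)} - 1) u_{α+k}`,
a formal series of monomials. -/
def hamiltonian (ω : ℂ) (ℓ : ℕ) : QSeries ω :=
  ∑ α ∈ indexSet ℓ, QSeries.formalSum fun k : ℤ =>
    aeval ω (hamCoeff α) • toSeries ω (proj ω (word ℂ fun j => α j + k))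

/-- In the formal sum defining the Hamiltonian every monomial occurs only finitely often. -/
theorem hamiltonian_locallyFinite (ω c : ℂ) {ℓ : ℕ} (hℓ : 1 ≤ ℓ) (α : Fin ℓ → ℤ)
    (a : ℤ →₀ ℕ) :
    {k : ℤ | (c • toSeries ω (proj ω (word ℂ fun j => α j + k))).coeff a ≠ 0}.Finite := by
  classical
  refine (a.support.image fun n => n - α ⟨0, hℓ⟩).finite_toSet.subset ?_
  intro k hk
  simp only [Set.mem_ofPred_eq, toSeries_proj, word_eq] at hk
  obtain ⟨e, he⟩ := freeToSeries_list ω (List.ofFn fun j => α j + k)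
  rw [he, listWt_ofFn, QSeries.coeff_smul, QSeries.coeff_single] at hk
  have ha : a = wt fun j => α j + k := by
    by_contra h
    simp [h] at hk
  simp only [Finset.coe_image, Set.mem_image, Finset.mem_coe, Finsupp.mem_support_iff]
  refine ⟨α ⟨0, hℓ⟩ + k, ?_, by ring⟩
  rw [ha, wt, Finsupp.finsetSum_apply]
  refine (Finset.sum_pos' (fun _ _ => Nat.zero_le _) ⟨⟨0, hℓ⟩, Finset.mem_univ _, ?_⟩).ne'
  simp

/-- The Hermitian conjugation: it is conjugate linear and sends the normally ordered monomial
`u^a` to the same product in the opposite order, which is `ω^{∑ a_n a_{n+1}} u^a`. -/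
def dagger {ω : ℂ} (f : QSeries ω) : QSeries ω :=
  ⟨fun a => ω ^ cocycle a a * (starRingEnd ℂ) (f.coeff a)⟩

theorem dagger_add {ω : ℂ} (f g : QSeries ω) : dagger (f + g) = dagger f + dagger g := by
  ext a; simp [dagger, mul_add]

theorem dagger_smul {ω : ℂ} (c : ℂ) (f : QSeries ω) :
    dagger (c • f) = (starRingEnd ℂ) c • dagger f := by
  ext a; simp only [dagger, QSeries.coeff_smul, map_mul]; ring

theorem dagger_u (ω : ℂ) (n : ℤ) :
    dagger (toSeries ω (proj ω (u ℂ n))) = toSeries ω (proj ω (u ℂ n)) := by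
  rw [toSeries_proj, freeToSeries_u]
  ext a
  by_cases h : a = Finsupp.single n 1
  · subst h
    simp [dagger, QSeries.coeff_single, cocycle_single_left]
  · simp [dagger, QSeries.coeff_single, h]

/-- For `|ω| = 1`, that is `ω† = ω⁻¹`, the conjugation reverses products. -/
theorem dagger_mul {ω : ℂ} (hω : ω * (starRingEnd ℂ) ω = 1) (f g : QSeries ω) :
    dagger (f * g) = dagger g * dagger f := by
  ext a
  simp only [dagger, QSeries.coeff_mul, map_sum, Finset.mul_sum]
  refine Finset.sum_nbij' Prod.swap Prod.swap ?_ ?_ (fun _ _ => rfl) (fun _ _ => rfl) ?_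
  · rintro ⟨x, y⟩ h
    rw [Finset.HasAntidiagonal.mem_antidiagonal] at h ⊢
    rw [← h]; exact add_comm _ _
  · rintro ⟨x, y⟩ h
    rw [Finset.HasAntidiagonal.mem_antidiagonal] at h ⊢
    rw [← h]; exact add_comm _ _
  · rintro ⟨x, y⟩ h
    rw [Finset.HasAntidiagonal.mem_antidiagonal] at h
    dsimp only at h
    subst h
    have h1 : ω ^ cocycle x y * (starRingEnd ℂ) ω ^ cocycle x y = 1 := by
      rw [← mul_pow, hω, one_pow]
    simp only [Prod.swap, cocycle_add_left, cocycle_add_right, pow_add, map_mul, map_pow]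
    linear_combination (ω ^ cocycle x x * ω ^ cocycle y x * ω ^ cocycle y y *
      (starRingEnd ℂ) (f.coeff x) * (starRingEnd ℂ) (g.coeff y)) * h1

theorem dagger_dagger {ω : ℂ} (hω : ω * (starRingEnd ℂ) ω = 1) (f : QSeries ω) :
    dagger (dagger f) = f := by
  ext a
  have h1 : ω ^ cocycle a a * (starRingEnd ℂ) ω ^ cocycle a a = 1 := by
    rw [← mul_pow, hω, one_pow]
  simp only [dagger, map_mul, map_pow, Complex.conj_conj]
  rw [← mul_assoc, h1, one_mul]

end Volterra

end

/-! Write `e_n` for the exponent of `u_n`. Since `u^a u_n = ω^{a_{n-1}} u^{a+e_n}` and `u_n u^a =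
ω^{a_{n+1}} u^{a+e_n}`, a series with coefficients `h(a)` has commutators `(1-ω^ℓ)(S^{n+1}(X) u_n -
u_n S^{n-1}(X))` with the generators as soon as `h(a)(ω^{a_k}-1) = (ω^ℓ-1) w_k(a)` for every level
`k`, where `w_k(a)` is the coefficient of `u^a` in `S^k(X^{(ℓ)})` (`lie_gen`). The trigonometric
prefactor then turns `1-ω^ℓ` into `q^ℓ`.

Such an `h` exists because `w_k` is a product of Gaussian binomials, one for each pair of
neighbouring levels, and passing from `k` to `k+1` changes a single factor: `(ω^{a_{k+1}}-1) w_k =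
(ω^{a_k}-1) w_{k+1}` (`walkWeight_exchange`). Hence `w_k/(ω^{a_k}-1)` is the same at all occupied
levels, and telescoping `ω^ℓ-1` over the levels makes `h` a polynomial (`dvd_P_mul`). The product
formula comes from the Lax operator `L = S + u S⁻¹`: `S^k(X^{(ℓ)})` is a matrix element of
`L^{2ℓ-1}`, and the recursion for powers of `L` becomes the q-Pascal rule (`walkWeight_step`,
`coeff_entry_lax_pow`). Hermiticity says that `h(a)` is palindromic of the degree by which reversing
`u^a` multiplies it (`palindromic_hamCoeff`).

For commutativity, commutation with `H_ℓ` acts on `L` as commutation with the nonnegative part of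
`(1-ω^ℓ)L^{2ℓ}`. The zero curvature argument shows that `[H_ℓ,H_m]` commutes with every `u_n`
(`DiffOp.const_lie_eq_zero`). For indeterminate `ω` only constants do so, and a commutator has no
constant term here. All coefficients are polynomials in `ω`, so the identity specialises to every
`ω`, including roots of unity, where the centre is larger. -/

noncomputable section

namespace Volterra

/-! ### Gaussian binomial coefficients -/

section QBinom

variable {R : Type*} [CommRing R]

/-- The Gaussian binomial coefficient at `ω`, defined by the `q`-Pascal recursion. -/
def qBinom (ω : R) : ℕ → ℕ → R
  | _, 0 => 1
  | 0, _ + 1 => 0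
  | n + 1, k + 1 => qBinom ω n k + ω ^ (k + 1) * qBinom ω n (k + 1)

variable (ω : R)

@[simp] theorem qBinom_zero_right (n : ℕ) : qBinom ω n 0 = 1 := by cases n <;> rfl

theorem qBinom_succ (n k : ℕ) :
    qBinom ω (n + 1) (k + 1) = qBinom ω n k + ω ^ (k + 1) * qBinom ω n (k + 1) := rfl

theorem qBinom_of_lt {n k : ℕ} (h : n < k) : qBinom ω n k = 0 := by
  induction n generalizing k with
  | zero => obtain ⟨k, rfl⟩ := Nat.exists_eq_succ_of_ne_zero h.ne'; rfl
  | succ n ih =>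
    obtain ⟨k, rfl⟩ := Nat.exists_eq_succ_of_ne_zero (Nat.ne_zero_of_lt h)
    rw [Nat.succ_eq_add_one, qBinom_succ, ih (by omega), ih (by omega)]
    simp

@[simp] theorem qBinom_self (n : ℕ) : qBinom ω n n = 1 := by
  induction n with
  | zero => rfl
  | succ n ih => rw [qBinom_succ, ih, qBinom_of_lt ω (Nat.lt_succ_self n)]; simp

/-- The second form of the `q`-Pascal recursion. -/
theorem qBinom_succ' (x y : ℕ) :
    qBinom ω (x + y + 1) (x + 1) = qBinom ω (x + y) (x + 1) + ω ^ y * qBinom ω (x + y) x := by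
  induction y generalizing x with
  | zero => simp [qBinom_of_lt ω (Nat.lt_succ_self x)]
  | succ y ih =>
    induction x with
    | zero =>
      have h := ih 0
      simp only [zero_add, qBinom_zero_right, mul_one] at h ⊢
      rw [qBinom_succ, h]
      have h2 := qBinom_succ ω y 0
      rw [zero_add, h] at h2
      simp only [zero_add, qBinom_zero_right] at h2 ⊢
      linear_combination -h2
    | succ x ihx =>
      have e1 : x + 1 + (y + 1) = (x + (y + 1)) + 1 := by ring
      have e2 : x + 1 + y = x + (y + 1) := by ring
      have h1 := ih (x + 1)
      rw [e2] at h1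
      have h2 := qBinom_succ ω (x + (y + 1)) x
      have h3 := qBinom_succ ω (x + (y + 1)) (x + 1)
      rw [e1, qBinom_succ ω (x + (y + 1) + 1), ihx, h1]
      rw [ihx] at h2
      rw [h1] at h3
      linear_combination -h3 - ω ^ (y + 1) * h2

theorem qBinom_symm (x y : ℕ) : qBinom ω (x + y) x = qBinom ω (x + y) y := by
  induction x generalizing y with
  | zero => simp
  | succ x ih =>
    induction y with
    | zero => simp
    | succ y ihy =>
      have h1 := qBinom_succ' ω y (x + 1)
      have h2 := qBinom_succ ω (x + (y + 1)) x
      rw [show y + (x + 1) = x + (y + 1) by ring] at h1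
      rw [show x + 1 + (y + 1) = x + (y + 1) + 1 by ring, h1, h2, ih (y + 1)]
      rw [show x + 1 + y = x + (y + 1) by ring] at ihy
      rw [ihy]

/-- Equate the two Pascal expansions of the same coefficient. For `n < k` the truncated exponent is
harmless, since both binomials vanish. -/
theorem qBinom_ratio (n k : ℕ) :
    qBinom ω n (k + 1) * (ω ^ (k + 1) - 1) = (ω ^ (n - k) - 1) * qBinom ω n k := by
  rcases le_or_gt k n with h | h
  · obtain ⟨y, rfl⟩ := Nat.exists_eq_add_of_le h
    rw [Nat.add_sub_cancel_left]
    linear_combination qBinom_succ' ω k y - qBinom_succ ω (k + y) k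
  · rw [qBinom_of_lt ω h, qBinom_of_lt ω (by omega)]
    simp

/-- The exchange rule that moves the marked letter across a bond. -/
theorem qBinom_exchange (a b : ℕ) :
    (ω ^ b - 1) * qBinom ω (a + b - 1) b = (ω ^ a - 1) * qBinom ω (a + b - 1) a := by
  rcases Nat.eq_zero_or_pos a with rfl | ha
  · rcases Nat.eq_zero_or_pos b with rfl | hb
    · rfl
    · rw [qBinom_of_lt ω (by omega)]; simp
  obtain ⟨a, rfl⟩ := Nat.exists_eq_succ_of_ne_zero ha.ne'
  rcases Nat.eq_zero_or_pos b with rfl | hb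
  · rw [qBinom_of_lt ω (k := a.succ) (by omega)]; simp
  obtain ⟨b, rfl⟩ := Nat.exists_eq_succ_of_ne_zero hb.ne'
  -- The two sides are consecutive binomials in the row `a + b - 1`, up to the symmetry of that row.
  have h := qBinom_ratio ω (b + (a + 1)) b
  have h2 := qBinom_symm ω b (a + 1)
  rw [h2, Nat.add_sub_cancel_left] at h
  rw [show a.succ + b.succ - 1 = b + (a + 1) by omega, Nat.succ_eq_add_one, Nat.succ_eq_add_one]
  linear_combination h

/-- Telescopes `qBinom_ratio`. Being free of division, it needs no cancellation in `R`. -/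
theorem qBinom_mul_prod (n r : ℕ) :
    qBinom ω n r * ∏ i ∈ Finset.range r, (ω ^ (i + 1) - 1)
      = ∏ i ∈ Finset.range r, (ω ^ (n - i) - 1) := by
  induction r with
  | zero => simp
  | succ r ih =>
    rw [Finset.prod_range_succ, Finset.prod_range_succ, ← ih]
    linear_combination (∏ i ∈ Finset.range r, (ω ^ (i + 1) - 1)) * qBinom_ratio ω n r

theorem map_qBinom {S : Type*} [CommRing S] (f : R →+* S) (n k : ℕ) :
    f (qBinom ω n k) = qBinom (f ω) n k := by
  induction n generalizing k with
  | zero => cases k <;> simp [qBinom]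
  | succ n ih => cases k <;> simp [qBinom, ih]

/-- The denominator is monic, so polynomial division returns the exact quotient. -/
theorem gaussBinom_eq_qBinom (m r : ℕ) : gaussBinom m r = qBinom X m r := by
  rw [gaussBinom, ← qBinom_mul_prod, mul_comm, mul_divByMonic_cancel_left]
  refine monic_prod_of_monic _ _ fun i _ => ?_
  simpa using monic_X_pow_sub_C (1 : ℤ) (Nat.succ_ne_zero i)

end QBinom

/-! ### Palindromic polynomials -/

/-- `p` has degree at most `d`, and `X^d p(1/X) = p(X)`. -/
def Palindromic (d : ℕ) (p : ℤ[X]) : Prop := p.natDegree ≤ d ∧ p.reflect d = p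

namespace Palindromic

theorem one : Palindromic 0 1 := ⟨by simp, by simp⟩

theorem mul {c d : ℕ} {p q : ℤ[X]} (hp : Palindromic c p) (hq : Palindromic d q) :
    Palindromic (c + d) (p * q) :=
  ⟨natDegree_mul_le.trans (add_le_add hp.1 hq.1), by rw [reflect_mul _ _ hp.1 hq.1, hp.2, hq.2]⟩

theorem prod {ι : Type*} (s : Finset ι) (d : ι → ℕ) (p : ι → ℤ[X])
    (h : ∀ i ∈ s, Palindromic (d i) (p i)) :
    Palindromic (∑ i ∈ s, d i) (∏ i ∈ s, p i) := by
  classical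
  induction s using Finset.induction_on with
  | empty => exact one
  | insert i s hi ih =>
    rw [Finset.sum_insert hi, Finset.prod_insert hi]
    exact (h i (Finset.mem_insert_self i s)).mul
      (ih fun j hj => h j (Finset.mem_insert_of_mem hj))

theorem reflect_X_pow_sub_one (m : ℕ) : (X ^ m - 1 : ℤ[X]).reflect m = 1 - X ^ m := by
  rw [reflect_sub, reflect_monomial, reflect_one, revAt_le le_rfl, Nat.sub_self, pow_zero]

theorem natDegree_X_pow_sub_one (m : ℕ) : (X ^ m - 1 : ℤ[X]).natDegree = m := by
  simpa using natDegree_X_pow_sub_C (n := m) (r := (1 : ℤ))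

/-- Reflection is multiplicative and changes the sign of both `X^m - 1` and `X^l - 1`. The signs
cancel, and then so does the nonzero factor `X^m - 1`. -/
theorem of_mul_eq {c d m l : ℕ} {h p : ℤ[X]} (hm : m ≠ 0) (hp : Palindromic d p)
    (hd : c + m = d + l) (heq : h * (X ^ m - 1) = p * (X ^ l - 1)) : Palindromic c h := by
  rcases eq_or_ne h 0 with rfl | h0
  · exact ⟨by simp, by simp⟩
  have hX : (X ^ m - 1 : ℤ[X]) ≠ 0 := by
    simpa using X_pow_sub_C_ne_zero (Nat.pos_of_ne_zero hm) (1 : ℤ)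
  have hdeg : h.natDegree ≤ c := by
    have h1 := natDegree_mul h0 hX
    have h2 := natDegree_mul_le (p := p) (q := X ^ l - 1)
    rw [heq] at h1
    rw [natDegree_X_pow_sub_one] at h1 h2
    have := hp.1
    omega
  refine ⟨hdeg, ?_⟩
  have h1 := reflect_mul h (X ^ m - 1) hdeg (natDegree_X_pow_sub_one m).le
  rw [heq, hd, reflect_mul _ _ hp.1 (natDegree_X_pow_sub_one l).le, hp.2, reflect_X_pow_sub_one,
    reflect_X_pow_sub_one] at h1
  apply mul_right_cancel₀ hX
  rw [heq]
  linear_combination h1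

theorem qBinom (x y : ℕ) : Palindromic (x * y) (qBinom (X : ℤ[X]) (x + y) x) := by
  induction x generalizing y with
  | zero => simpa using one
  | succ x ih =>
    induction y with
    | zero => simpa using one
    | succ y ihy =>
      have h1 := ih (y + 1)
      have e : x + 1 + y = x + (y + 1) := by ring
      rw [e] at ihy
      have hA := qBinom_succ (X : ℤ[X]) (x + (y + 1)) x
      have hB := qBinom_succ' (X : ℤ[X]) x (y + 1)
      have d1 : (x + 1) * (y + 1) = (y + 1) + x * (y + 1) := by ring
      have d2 : (x + 1) * (y + 1) = (x + 1) + (x + 1) * y := by ring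
      rw [show x + 1 + (y + 1) = x + (y + 1) + 1 by ring]
      constructor
      · rw [hA]
        refine natDegree_add_le_of_degree_le ?_ ?_
        · exact h1.1.trans (by rw [d1]; omega)
        · rw [d2]
          exact natDegree_mul_le.trans (add_le_add (natDegree_X_pow_le _) ihy.1)
      -- Reflection exchanges the summands of the two Pascal recursions.
      · conv_lhs => rw [hA]
        rw [hB, reflect_add]
        have r1 : (Volterra.qBinom (X : ℤ[X]) (x + (y + 1)) x).reflect ((x + 1) * (y + 1))
            = X ^ (y + 1) * Volterra.qBinom (X : ℤ[X]) (x + (y + 1)) x := by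
          rw [d1]
          have := reflect_mul 1 (Volterra.qBinom (X : ℤ[X]) (x + (y + 1)) x) (F := y + 1)
            (by simp) h1.1
          rwa [one_mul, reflect_one, h1.2] at this
        have r2 : (X ^ (x + 1) * Volterra.qBinom (X : ℤ[X]) (x + (y + 1)) (x + 1)).reflect
            ((x + 1) * (y + 1)) = Volterra.qBinom (X : ℤ[X]) (x + (y + 1)) (x + 1) := by
          rw [d2, reflect_mul _ _ (natDegree_X_pow_le _) ihy.1, ihy.2, reflect_monomial,
            revAt_le le_rfl]
          simp
        rw [r1, r2, add_comm]

/-- The coefficients are integers and `ω` has conjugate `ω⁻¹`, so conjugating `p(ω)` gives `p(ω⁻¹)`.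
-/
theorem conj_aeval {d : ℕ} {p : ℤ[X]} (h : Palindromic d p) {ω : ℂ}
    (hω : ω * (starRingEnd ℂ) ω = 1) : ω ^ d * (starRingEnd ℂ) (aeval ω p) = aeval ω p := by
  have h0 : ω ≠ 0 := left_ne_zero_of_mul_eq_one hω
  let _ := invertibleOfNonzero h0
  have h1 := eval₂_reflect_mul_pow (algebraMap ℤ ℂ) ω d p h.1
  rw [h.2] at h1
  have h2 : (starRingEnd ℂ) ω = ⅟ω := by
    rw [invOf_eq_inv]
    exact eq_inv_of_mul_eq_one_right hω
  have h3 : (starRingEnd ℂ) (aeval ω p) = aeval ((starRingEnd ℂ) ω) p := by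
    rw [aeval_def, aeval_def, hom_eval₂, RingHom.ext_int ((starRingEnd ℂ).comp _) (algebraMap ℤ ℂ)]
  rw [h3, h2, aeval_def, aeval_def, mul_comm]
  exact h1

end Palindromic

/-! ### Weights of lattice walks -/

section WalkWeight

variable {R : Type*} [CommRing R]

/-- The contribution of the levels `i`, `i + 1` to the weight of the words which start at a
level at least `s`, end at a level at most `e`, and have the multiplicities `a`. -/
def bond (ω : R) (s e : ℤ) (a : ℤ →₀ ℕ) (i : ℤ) : R :=
  -- In the subword of letters `i`, `i+1`, each `i` standing before an `i+1` costs one `ω`. If `s >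
  -- i`, the subword must begin with `i+1`; if `e ≤ i`, it must end with `i`, because descents are
  -- by one. The four cases impose neither, one or both conditions, and each forced letter lowers
  -- the row of the binomial by one.
  if s ≤ i then
    if e ≤ i then qBinom ω (a i + a (i + 1) - 1) (a (i + 1)) else qBinom ω (a i + a (i + 1)) (a i)
  else
    if e ≤ i then qBinom ω (a i + a (i + 1) - 2) (a (i + 1) - 1)
    else qBinom ω (a i + a (i + 1) - 1) (a i)

/-- The total weight of the words with multiplicities `a` that start at a level at least `s`, end
at a level at most `e` and never descend by more than one. -/
def walkWeight (ω : R) (s e : ℤ) (a : ℤ →₀ ℕ) : R :=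
  -- A word descending from `s` or above to `e` or below meets every level between. For `s < e` the
  -- condition is vacuous.
  open Classical in if ∀ i, e ≤ i → i ≤ s → a i ≠ 0 then ∏ᶠ i, bond ω s e a i else 0

variable (ω : R) {s e : ℤ} {a : ℤ →₀ ℕ}

theorem bond_eq_one {i : ℤ} (h : a i = 0) (h' : a (i + 1) = 0) : bond ω s e a i = 1 := by
  simp [bond, h, h']

theorem finprod_bond_eq_prod (s e : ℤ) {a : ℤ →₀ ℕ} (J : Finset ℤ)
    (hJ : ∀ i, i ∉ J → a i = 0 ∧ a (i + 1) = 0) :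
    ∏ᶠ i, bond ω s e a i = ∏ i ∈ J, bond ω s e a i := by
  apply finprod_eq_prod_of_mulSupport_subset
  intro i hi
  by_contra h
  exact hi (bond_eq_one ω (hJ i h).1 (hJ i h).2)

/-- A finite set of levels outside of which all bonds are trivial. -/
def bondSupport (a : ℤ →₀ ℕ) : Finset ℤ := a.support ∪ a.support.image fun i => i - 1

theorem eq_zero_of_notMem_bondSupport {i : ℤ} (h : i ∉ bondSupport a) :
    a i = 0 ∧ a (i + 1) = 0 := by
  simp only [bondSupport, Finset.mem_union, Finset.mem_image, Finsupp.mem_support_iff,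
    not_or, not_not, not_exists, not_and] at h
  refine ⟨h.1, ?_⟩
  by_contra h'
  exact h.2 (i + 1) h' (by ring)

/-- The three products compared by the recursion on the first letter differ only in the bond `s`;
the bond `s - 1` and the rest `r` are shared. Deleting a letter `s` and lowering the start together
preserve the bond `s - 1`: the deleted letter was the one forced to come first there. -/
theorem finprod_bond_split (s e : ℤ) (a : ℤ →₀ ℕ) : ∃ r : R,
    ∏ᶠ i, bond ω s e a i = bond ω s e a (s - 1) * bond ω s e a s * r ∧
    ∏ᶠ i, bond ω (s + 1) e a i = bond ω s e a (s - 1) * bond ω (s + 1) e a s * r ∧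
    (a s ≠ 0 → ∏ᶠ i, bond ω (s - 1) e (a - Finsupp.single s 1) i
      = bond ω s e a (s - 1) * bond ω (s - 1) e (a - Finsupp.single s 1) s * r) := by
  classical
  set J : Finset ℤ := insert (s - 1) (insert s (bondSupport a \ {s - 1, s})) with hJdef
  have hJ : ∀ i, i ∉ J → a i = 0 ∧ a (i + 1) = 0 := by
    intro i hi
    apply eq_zero_of_notMem_bondSupport
    intro h
    apply hi
    simp only [hJdef, Finset.mem_insert, Finset.mem_sdiff, Finset.mem_singleton]
    tauto
  have hsplit : ∀ f : ℤ → R,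
      ∏ i ∈ J, f i = f (s - 1) * f s * ∏ i ∈ bondSupport a \ {s - 1, s}, f i := by
    intro f
    rw [hJdef, Finset.prod_insert, Finset.prod_insert, mul_assoc]
    · simp
    · simp
  refine ⟨∏ i ∈ bondSupport a \ {s - 1, s}, bond ω s e a i, ?_, ?_, ?_⟩
  · rw [finprod_bond_eq_prod ω _ _ J hJ, hsplit]
  · rw [finprod_bond_eq_prod ω _ _ J hJ, hsplit]
    have h1 : bond ω (s + 1) e a (s - 1) = bond ω s e a (s - 1) := by
      simp only [bond]
      rw [if_neg (by omega : ¬ s + 1 ≤ s - 1), if_neg (by omega : ¬ s ≤ s - 1)]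
    rw [h1]
    congr 1
    refine Finset.prod_congr rfl fun i hi => ?_
    simp only [Finset.mem_sdiff, Finset.mem_insert, Finset.mem_singleton, not_or] at hi
    simp only [bond]
    congr 1
    simp only [eq_iff_iff]
    omega
  · intro has
    have hJ' : ∀ i, i ∉ J → (a - Finsupp.single s 1 : ℤ →₀ ℕ) i = 0 ∧
        (a - Finsupp.single s 1 : ℤ →₀ ℕ) (i + 1) = 0 := by
      intro i hi
      simp [(hJ i hi).1, (hJ i hi).2]
    rw [finprod_bond_eq_prod ω _ _ J hJ', hsplit]
    have e1 : (a - Finsupp.single s 1 : ℤ →₀ ℕ) s = a s - 1 := by simp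
    have e2 : ∀ i, i ≠ s → (a - Finsupp.single s 1 : ℤ →₀ ℕ) i = a i := by
      intro i hi
      simp [Ne.symm hi]
    have h1 : bond ω (s - 1) e (a - Finsupp.single s 1) (s - 1) = bond ω s e a (s - 1) := by
      simp only [bond]
      rw [if_pos le_rfl, if_neg (by omega : ¬ s ≤ s - 1), sub_add_cancel, e1, e2 _ (by omega),
        show a (s - 1) + (a s - 1) - 1 = a (s - 1) + a s - 2 by omega,
        show a (s - 1) + (a s - 1) = a (s - 1) + a s - 1 by omega]
    rw [h1]
    congr 1
    refine Finset.prod_congr rfl fun i hi => ?_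
    simp only [Finset.mem_sdiff, Finset.mem_insert, Finset.mem_singleton, not_or] at hi
    simp only [bond]
    rw [e2 i (by omega), e2 (i + 1) (by omega)]
    congr 1
    simp only [eq_iff_iff]
    omega

theorem finprod_bond_eq_zero {i : ℤ} (h : bond ω s e a i = 0) : ∏ᶠ i, bond ω s e a i = 0 := by
  classical
  rw [finprod_bond_eq_prod ω _ _ (insert i (bondSupport a))
    fun j hj => eq_zero_of_notMem_bondSupport fun h => hj (Finset.mem_insert_of_mem h)]
  exact Finset.prod_eq_zero (Finset.mem_insert_self _ _) h

theorem walkWeight_zero (s e : ℤ) : walkWeight ω s e 0 = if s < e then 1 else 0 := by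
  rw [walkWeight]
  by_cases h : s < e
  · rw [if_pos h, if_pos (by intro i h1 h2; omega),
      finprod_bond_eq_prod ω _ _ ∅ (by simp), Finset.prod_empty]
  · rw [if_neg h, if_neg]
    intro h'
    exact h' e le_rfl (by omega) rfl

/-- Above the endpoints the occupied levels form an interval, unless the weight vanishes. -/
theorem ne_zero_of_bond_above (hs : ∀ i, e ≤ i → bond ω s e a i ≠ 0) {k : ℤ} (hk : e ≤ k)
    (hsk : s ≤ k) {n : ℕ} (h : a (k + n) ≠ 0) : a k ≠ 0 := by
  induction n with
  | zero => simpa using h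
  | succ n ih =>
    apply ih
    intro h0
    apply hs (k + n) (by omega)
    -- An empty level below an occupied one gives the binomial of `y - 1` over `y` with `y > 0`,
    -- which is zero.
    rw [bond, if_pos (by omega), if_pos (by omega), h0]
    apply qBinom_of_lt
    push_cast at h
    rw [← add_assoc] at h
    omega

/-- Below the endpoints the occupied levels form an interval, unless the weight vanishes. -/
theorem ne_zero_of_bond_below (hs : ∀ i, i < e → bond ω s e a i ≠ 0) {k : ℤ} (hk : k ≤ e)
    (hsk : k ≤ s) {n : ℕ} (h : a (k - n) ≠ 0) : a k ≠ 0 := by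
  induction n with
  | zero => simpa using h
  | succ n ih =>
    apply ih
    intro h0
    push_cast at h
    apply hs (k - (n + 1)) (by omega)
    rw [bond, if_neg (by omega), if_neg (by omega),
      show k - ((n : ℤ) + 1) + 1 = k - n by ring, h0]
    apply qBinom_of_lt
    omega

/-- The first letter of a word is either larger than `s`, or equal to `s`. -/
theorem walkWeight_step (s e : ℤ) (ha : a ≠ 0) :
    walkWeight ω s e a = walkWeight ω (s + 1) e a +
      if a s = 0 then 0 else
        ω ^ a (s + 1) * walkWeight ω (s - 1) e (a - Finsupp.single s 1 : ℤ →₀ ℕ) := by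
  obtain ⟨r, h0, h1, h2⟩ := finprod_bond_split ω s e a
  have e1 : (a - Finsupp.single s 1 : ℤ →₀ ℕ) s = a s - 1 := by simp
  have e2 : ∀ i, i ≠ s → (a - Finsupp.single s 1 : ℤ →₀ ℕ) i = a i := by
    intro i hi
    simp [Ne.symm hi]
  simp only [walkWeight]
  rcases le_or_gt e s with hes | hes
  · by_cases has : a s = 0
    · rw [if_pos has, if_neg fun h => h s hes le_rfl has,
        if_neg fun h => h s hes (by omega) has, add_zero]
    · rw [if_neg has]
      by_cases hI : ∀ i, e ≤ i → i ≤ s → a i ≠ 0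
      · have hI2 : ∀ i, e ≤ i → i ≤ s - 1 → (a - Finsupp.single s 1 : ℤ →₀ ℕ) i ≠ 0 := by
          intro i hi hi'
          rw [e2 i (by omega)]
          exact hI i hi (by omega)
        rw [if_pos hI, if_pos hI2, h0, h2 has]
        have b0 : bond ω s e a s = qBinom ω (a s + a (s + 1) - 1) (a (s + 1)) := by
          rw [bond, if_pos le_rfl, if_pos hes]
        have b2 : bond ω (s - 1) e (a - Finsupp.single s 1) s
            = qBinom ω (a s - 1 + a (s + 1) - 1) (a (s + 1)) := by
          rw [bond, if_pos (by omega), if_pos hes, e1, e2 _ (by omega)]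
        by_cases hs1 : a (s + 1) = 0
        · rw [if_neg fun h => h (s + 1) (by omega) le_rfl hs1, b0, b2, hs1]
          simp
        · have hI1 : ∀ i, e ≤ i → i ≤ s + 1 → a i ≠ 0 := by
            intro i hi hi'
            rcases eq_or_ne i (s + 1) with rfl | hne
            · exact hs1
            · exact hI i hi (by omega)
          have b1 : bond ω (s + 1) e a s = qBinom ω (a s + a (s + 1) - 2) (a (s + 1) - 1) := by
            rw [bond, if_neg (by omega), if_pos hes]
          rw [if_pos hI1, h1, b0, b1, b2]
          obtain ⟨x, hx⟩ := Nat.exists_eq_succ_of_ne_zero has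
          obtain ⟨y, hy⟩ := Nat.exists_eq_succ_of_ne_zero hs1
          -- The Pascal rule splits by the first letter of the subword on `s`, `s+1`: either `s+1`,
          -- or `s` at the cost of passing all `y + 1` letters `s+1`.
          have hp := qBinom_succ ω (x + y) y
          rw [hx, hy, show x.succ + y.succ - 1 = x + y + 1 by omega,
            show x.succ + y.succ - 2 = x + y by omega,
            show x.succ - 1 + y.succ - 1 = x + y by omega, show y.succ - 1 = y by omega,
            Nat.succ_eq_add_one, hp]
          ring
      · have hI2 : ¬ ∀ i, e ≤ i → i ≤ s - 1 → (a - Finsupp.single s 1 : ℤ →₀ ℕ) i ≠ 0 := by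
          intro h
          apply hI
          intro i hi hi'
          rcases eq_or_ne i s with rfl | hne
          · exact has
          · have := h i hi (by omega)
            rwa [e2 i hne] at this
        rw [if_neg hI, if_neg hI2, if_neg fun h => hI fun i hi hi' => h i hi (by omega)]
        simp
  · rw [if_pos (by intro i h1 h2; omega),
      if_pos (by intro i h1 h2; omega : ∀ i, e ≤ i → i ≤ s - 1 → _ ≠ 0), h0]
    have b0 : bond ω s e a s = qBinom ω (a s + a (s + 1)) (a s) := by
      rw [bond, if_pos le_rfl, if_neg (by omega)]
    have b1 : bond ω (s + 1) e a s = qBinom ω (a s + a (s + 1) - 1) (a s) := by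
      rw [bond, if_neg (by omega), if_neg (by omega)]
    have b2 : bond ω (s - 1) e (a - Finsupp.single s 1) s
        = qBinom ω (a s - 1 + a (s + 1)) (a s - 1) := by
      rw [bond, if_pos (by omega), if_neg (by omega), e1, e2 _ (by omega)]
    by_cases has : a s = 0
    · rw [if_pos has, add_zero]
      split_ifs with hI
      · rw [h1, b0, b1, has]
        simp
      · push Not at hI
        obtain ⟨i, hi, hi', hai⟩ := hI
        obtain rfl : i = s + 1 := by omega
        obtain rfl : e = s + 1 := by omega
        -- Here both levels `s` and `s + 1 = e` are empty. If no bond vanished, everything above and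
        -- below them would be empty too, contradicting `a ≠ 0`.
        rw [← h0]
        by_contra hne
        have hb : ∀ i, bond ω s (s + 1) a i ≠ 0 := fun i h => hne (finprod_bond_eq_zero ω h)
        apply ha
        ext j
        by_contra hj
        rcases le_or_gt (s + 1) j with h | h
        · refine ne_zero_of_bond_above ω (fun i _ => hb i) le_rfl (by omega)
            (n := (j - (s + 1)).toNat) ?_ hai
          rwa [Int.toNat_of_nonneg (by omega), add_sub_cancel]
        · refine ne_zero_of_bond_below ω (fun i _ => hb i) (k := s) (by omega) le_rfl
            (n := (s - j).toNat) ?_ has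
          rwa [Int.toNat_of_nonneg (by omega), sub_sub_cancel]
    · rw [if_neg has, h2 has, b0, b2]
      obtain ⟨x, hx⟩ := Nat.exists_eq_succ_of_ne_zero has
      -- Without the condition on the last letter, the same split by the first letter is the other
      -- Pascal rule.
      have hp := qBinom_succ' ω x (a (s + 1))
      split_ifs with hI
      · rw [h1, b1, hx, show x.succ + a (s + 1) = x + a (s + 1) + 1 by omega,
          show x.succ - 1 + a (s + 1) = x + a (s + 1) by omega, Nat.add_sub_cancel,
          show x.succ - 1 = x by omega, Nat.succ_eq_add_one, hp]
        ring
      · push Not at hI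
        obtain ⟨i, hi, hi', hai⟩ := hI
        obtain rfl : i = s + 1 := by omega
        rw [hai, hx]
        simp

end WalkWeight

/-! ### Difference operators -/

/-- Sequences indexed by the levels, on which the difference operators act. -/
def LevelSeq (A : Type*) : Type _ := ℤ → A

instance {A : Type*} [Ring A] : Ring (LevelSeq A) := inferInstanceAs (Ring (ℤ → A))

/-- The translation action encodes `S f = f(· + 1) S` in the skew algebra. -/
instance {A : Type*} [Ring A] : MulSemiringAction (Multiplicative ℤ) (LevelSeq A) where
  smul g f := fun i => f (i + g.toAdd)
  one_smul f := by funext i; exact congrArg f (add_zero i)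
  mul_smul g h f := by
    funext i
    refine congrArg f ?_
    rw [toAdd_mul, add_assoc]
  smul_zero _ := rfl
  smul_add _ _ _ := rfl
  smul_one _ := rfl
  smul_mul _ _ _ := rfl

/-- The ring of difference operators `∑ f_d S^d`, where `S` is the shift of the level. -/
abbrev DiffOp (A : Type*) [Ring A] : Type _ := SkewMonoidAlgebra (LevelSeq A) (Multiplicative ℤ)

section DiffOp

variable {A : Type*} [Ring A]

namespace DiffOp

/-- The coefficient of `S^d` at the level `i`. -/
def entry (f : DiffOp A) (d i : ℤ) : A := f.coeff (Multiplicative.ofAdd d) i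

theorem ext_entry {f g : DiffOp A} (h : ∀ d i, f.entry d i = g.entry d i) : f = g :=
  SkewMonoidAlgebra.ext fun x => funext fun i => h x.toAdd i

@[simp] theorem entry_zero (d i : ℤ) : (0 : DiffOp A).entry d i = 0 := rfl

@[simp] theorem entry_add (f g : DiffOp A) (d i : ℤ) :
    (f + g).entry d i = f.entry d i + g.entry d i := by
  simp only [entry, SkewMonoidAlgebra.coeff_add]; rfl

@[simp] theorem entry_sub (f g : DiffOp A) (d i : ℤ) :
    (f - g).entry d i = f.entry d i - g.entry d i := by
  simp only [entry, SkewMonoidAlgebra.coeff_sub]; rfl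

theorem entry_one (d i : ℤ) : (1 : DiffOp A).entry d i = if d = 0 then 1 else 0 := by
  simp only [entry, SkewMonoidAlgebra.coeff_one, Finsupp.single_apply]
  by_cases h : d = 0
  · subst h; simp; rfl
  · rw [if_neg h, if_neg]
    · rfl
    · intro h'
      exact h (congrArg Multiplicative.toAdd h').symm

theorem entry_single (m d i : ℤ) (r : LevelSeq A) :
    entry (SkewMonoidAlgebra.single (Multiplicative.ofAdd m) r) d i
      = if m = d then r i else 0 := by
  simp only [entry, SkewMonoidAlgebra.coeff_single, Finsupp.single_apply,
    Multiplicative.ofAdd.injective.eq_iff]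
  split_ifs <;> rfl

theorem entry_single_mul (m : ℤ) (r : LevelSeq A) (f : DiffOp A) (d i : ℤ) :
    entry (SkewMonoidAlgebra.single (Multiplicative.ofAdd m) r * f) d i
      = r i * f.entry (d - m) (i + m) := by
  rw [entry, SkewMonoidAlgebra.coeff_single_mul, ← ofAdd_neg, ← ofAdd_add, neg_add_eq_sub]
  rfl

theorem entry_mul_single (m : ℤ) (r : LevelSeq A) (f : DiffOp A) (d i : ℤ) :
    entry (f * SkewMonoidAlgebra.single (Multiplicative.ofAdd m) r) d i
      = f.entry (d - m) i * r (i + (d - m)) := by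
  rw [entry, SkewMonoidAlgebra.coeff_mul_single, ← ofAdd_neg, ← ofAdd_add, ← sub_eq_add_neg]
  rfl

/-- The Lax operator `S + u S⁻¹`. -/
def lax (u : ℤ → A) : DiffOp A :=
  SkewMonoidAlgebra.single (Multiplicative.ofAdd 1) 1
    + SkewMonoidAlgebra.single (Multiplicative.ofAdd (-1)) (show LevelSeq A from u)

theorem entry_lax_mul (u : ℤ → A) (f : DiffOp A) (d i : ℤ) :
    (lax u * f).entry d i = f.entry (d - 1) (i + 1) + u i * f.entry (d + 1) (i - 1) := by
  rw [lax, add_mul, entry_add, entry_single_mul, entry_single_mul, sub_neg_eq_add,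
    ← sub_eq_add_neg]
  congr 1
  exact one_mul _

theorem entry_mul_lax (u : ℤ → A) (f : DiffOp A) (d i : ℤ) :
    (f * lax u).entry d i = f.entry (d - 1) i + f.entry (d + 1) i * u (i + d + 1) := by
  rw [lax, mul_add, entry_add, entry_mul_single, entry_mul_single, sub_neg_eq_add, add_assoc]
  congr 1
  exact mul_one _

variable (u : ℤ → A)

theorem entry_lax_pow_succ (k : ℕ) (d i : ℤ) : (lax u ^ (k + 1)).entry d i
    = (lax u ^ k).entry (d - 1) (i + 1) + u i * (lax u ^ k).entry (d + 1) (i - 1) := by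
  rw [pow_succ', entry_lax_mul]

theorem entry_lax_pow_of_parity (k : ℕ) {d : ℤ} (h : (d + k) % 2 = 1) (i : ℤ) :
    (lax u ^ k).entry d i = 0 := by
  induction k generalizing d i with
  | zero =>
    rw [pow_zero, entry_one, if_neg]
    rintro rfl
    simp at h
  | succ k ih =>
    push_cast at h
    rw [entry_lax_pow_succ, ih (by omega), ih (by omega)]
    simp

theorem entry_lax_pow_of_gt (k : ℕ) {d : ℤ} (h : k < d) (i : ℤ) :
    (lax u ^ k).entry d i = 0 := by
  induction k generalizing d i with
  | zero =>
    rw [pow_zero, entry_one, if_neg]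
    rintro rfl
    simp at h
  | succ k ih =>
    push_cast at h
    rw [entry_lax_pow_succ, ih (by omega), ih (by omega)]
    simp

theorem entry_lax_pow_top (k : ℕ) (i : ℤ) : (lax u ^ k).entry k i = 1 := by
  induction k generalizing i with
  | zero => simp [entry_one]
  | succ k ih =>
    rw [entry_lax_pow_succ, entry_lax_pow_of_gt u k (d := _ + 1) (by push_cast; omega)]
    push_cast
    rw [add_sub_cancel_right, ih]
    simp

theorem entry_lax_pow_shift (n : ℤ) (k : ℕ) (d i : ℤ) :
    (lax (fun m => u (m + n)) ^ k).entry d i = (lax u ^ k).entry d (i + n) := by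
  induction k generalizing d i with
  | zero => simp [entry_one]
  | succ k ih =>
    rw [entry_lax_pow_succ, entry_lax_pow_succ, ih, ih, add_right_comm, add_sub_right_comm]

end DiffOp

end DiffOp

/-! ### Admissible words as matrix elements of powers of the Lax operator -/

section Words

/-- The multi-indices that start at a level at least `s`, end at a level at most `0` and never
descend by more than one. -/
def walks (k : ℕ) (s : ℤ) : Finset (Fin k → ℤ) :=
  (Fintype.piFinset fun j : Fin k => Finset.Icc (s - (j : ℤ)) ((k : ℤ) - 1 - (j : ℤ))).filter
    fun α => ∀ i j : Fin k, (i : ℕ) + 1 = (j : ℕ) → α i ≤ α j + 1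

theorem walks_zero (k : ℕ) : walks k 0 = admissible k := by
  simp only [walks, admissible, zero_sub]

theorem cons_mem_walks {k : ℕ} {s x : ℤ} {β : Fin k → ℤ} :
    (Fin.cons x β : Fin (k + 1) → ℤ) ∈ walks (k + 1) s ↔ s ≤ x ∧ x ≤ k ∧ β ∈ walks k (x - 1) := by
  simp only [walks, Finset.mem_filter, Fintype.mem_piFinset, Finset.mem_Icc, Fin.forall_fin_succ,
    Fin.cons_zero, Fin.cons_succ, Fin.val_zero, Fin.val_succ]
  constructor
  · rintro ⟨⟨h0, h1⟩, ⟨-, h2⟩, h3⟩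
    push_cast at h0 h1
    refine ⟨by linarith, by linarith, fun j => ⟨?_, by linarith [(h1 j).2]⟩,
      fun i j hij => (h3 i).2 j (by omega)⟩
    -- Only the first letter needs a lower bound; the others inherit theirs from descents of at most
    -- one.
    obtain ⟨j, hj⟩ := j
    induction j with
    | zero => have := h2 ⟨0, hj⟩ rfl; push_cast; linarith
    | succ j ih =>
      have h4 := ih (by omega)
      have h5 := (h3 ⟨j, by omega⟩).2 ⟨j + 1, hj⟩ rfl
      push_cast at h4 ⊢
      linarith
  · rintro ⟨h1, h2, h3, h4⟩
    refine ⟨⟨by push_cast; constructor <;> linarith, fun j => ?_⟩, ⟨by simp, fun j hj => ?_⟩,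
      fun i => ⟨by simp, fun j hj => h4 i j (by omega)⟩⟩
    · have := h3 j
      push_cast
      constructor <;> linarith
    · have h5 := (h3 j).1
      have h6 : (j : ℕ) = 0 := by omega
      rw [h6] at h5
      push_cast at h5
      linarith

theorem walks_eq_empty {k : ℕ} (hk : k ≠ 0) {s : ℤ} (h : (k : ℤ) - 1 < s) : walks k s = ∅ := by
  obtain ⟨k, rfl⟩ := Nat.exists_eq_succ_of_ne_zero hk
  rw [Finset.eq_empty_iff_forall_notMem]
  intro α hα
  rw [← Fin.cons_self_tail α, cons_mem_walks] at hα
  push_cast at h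
  linarith [hα.1, hα.2.1]

theorem walks_succ {k : ℕ} {s : ℤ} (hs : s ≤ k) :
    walks (k + 1) s = (walks (k + 1) (s + 1)).disjUnion
      ((walks k (s - 1)).map ⟨fun β => (Fin.cons s β : Fin (k + 1) → ℤ),
        Fin.cons_right_injective (α := fun _ => ℤ) s⟩)
      (by
        rw [Finset.disjoint_left]
        intro α hα hα'
        obtain ⟨β, -, rfl⟩ := Finset.mem_map.1 hα'
        have := (cons_mem_walks.1 hα).1
        omega) := by
  ext α
  rw [← Fin.cons_self_tail α]
  generalize α 0 = x
  generalize Fin.tail α = β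
  simp only [Finset.mem_disjUnion, cons_mem_walks, Finset.mem_map, Function.Embedding.coeFn_mk,
    Fin.cons_inj]
  constructor
  · rintro ⟨h1, h2, h3⟩
    rcases eq_or_lt_of_le h1 with rfl | h
    · exact Or.inr ⟨β, h3, rfl, rfl⟩
    · exact Or.inl ⟨by omega, h2, h3⟩
  · rintro (⟨h1, h2, h3⟩ | ⟨γ, hγ, rfl, rfl⟩)
    · exact ⟨by omega, h2, h3⟩
    · exact ⟨le_rfl, hs, hγ⟩

/-- Expand `L^k` as paths from level `s` to level `-1`: a factor `S` goes up silently, a factor `u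
S⁻¹` records the current level and goes down. Going up before a letter makes the first one at least
`s` and each next one at least its predecessor minus one; ending at `-1` makes the last one at most
`0`. The relation on `k` says that exactly `ℓ` letters are recorded. -/
theorem entry_lax_pow_eq_sum {A : Type*} [Ring A] (u : ℤ → A) (ℓ k : ℕ) (s : ℤ)
    (h : (k : ℤ) = 2 * ℓ - 1 - s) :
    (DiffOp.lax u ^ k).entry (-1 - s) s
      = ∑ α ∈ walks ℓ s, (List.ofFn fun j => u (α j)).prod := by
  induction ℓ generalizing k s with
  | zero =>
    have h1 : -1 - s = k := by push_cast at h; linarith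
    rw [h1, DiffOp.entry_lax_pow_top]
    have h2 : walks 0 s = Finset.univ := by
      ext α
      simp [walks]
    simp [h2]
  | succ ℓ ih =>
    induction k generalizing s with
    | zero =>
      push_cast at h
      rw [pow_zero, DiffOp.entry_one, if_neg (by omega), walks_eq_empty (Nat.succ_ne_zero ℓ)
        (by push_cast; omega), Finset.sum_empty]
    | succ k ihk =>
      push_cast at h
      have h1 := ihk (s + 1) (by push_cast; linarith)
      have h2 := ih k (s - 1) (by linarith)
      rw [show -1 - (s + 1) = -1 - s - 1 by ring] at h1
      rw [show -1 - (s - 1) = -1 - s + 1 by ring] at h2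
      rw [DiffOp.entry_lax_pow_succ, h1, h2]
      rcases le_or_gt s ℓ with hs | hs
      · rw [walks_succ hs, Finset.sum_disjUnion, Finset.sum_map, Finset.mul_sum]
        congr 1
        refine Finset.sum_congr rfl fun β _ => ?_
        simp [List.ofFn_succ]
      -- The empty word always belongs to `walks 0`, so this case must be excluded; for `ℓ = 0` the
      -- relation on `k` forces `s ≤ 0`.
      · have hl : ℓ ≠ 0 := by rintro rfl; push_cast at hs h; omega
        rw [walks_eq_empty (Nat.succ_ne_zero ℓ) (by push_cast; omega),
          walks_eq_empty (Nat.succ_ne_zero ℓ) (by push_cast; omega), walks_eq_empty hl (by omega)]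
        simp

/-- The image of `S^n(X^{(ℓ)})` is a matrix element of the power `2ℓ - 1` of the Lax operator. -/
theorem map_shift_Xpoly {R A : Type*} [CommRing R] [Ring A] [Algebra R A]
    (φ : FreeAlgebra R ℤ →ₐ[R] A) {ℓ : ℕ} (hℓ : 1 ≤ ℓ) (n : ℤ) :
    φ (shift n (Xpoly R ℓ))
      = (DiffOp.lax (fun m => φ (u R m)) ^ (2 * ℓ - 1)).entry (-1) n := by
  have h := entry_lax_pow_eq_sum (fun m => φ (u R (m + n))) ℓ (2 * ℓ - 1) 0 (by omega)
  rw [sub_zero, DiffOp.entry_lax_pow_shift (fun m => φ (u R m)), zero_add, walks_zero] at h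
  rw [h, Xpoly, map_sum, map_sum]
  refine Finset.sum_congr rfl fun α _ => ?_
  rw [word, map_list_prod, map_list_prod, List.map_map, List.map_ofFn]
  congr 2
  funext j
  simp [shift, u]

end Words

/-! ### Coefficients of the powers of the Lax operator in the quantum algebra -/

section Coefficients

variable {R : Type*} [CommRing R] (ω : R)

/-- The generator `u_n` as a formal series. -/
def QSeries.gen (n : ℤ) : QSeries ω := QSeries.single (Finsupp.single n 1) 1

variable {ω}

theorem cocycle_single_right (n : ℤ) (x : ℕ) (b : ℤ →₀ ℕ) :
    cocycle b (Finsupp.single n x) = b (n - 1) * x := by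
  classical
  rw [cocycle, Finsupp.sum, Finset.sum_eq_single (n - 1)]
  · simp
  · intro m _ hm
    rw [Finsupp.single_apply, if_neg (by omega), mul_zero]
  · intro h
    rw [Finsupp.notMem_support_iff.1 h, zero_mul]

theorem sub_single_add {a : ℤ →₀ ℕ} {n : ℤ} (h : a n ≠ 0) :
    a - Finsupp.single n 1 + Finsupp.single n 1 = a := by
  ext m
  by_cases hm : n = m
  · subst hm
    simp
    omega
  · simp [hm]

theorem QSeries.coeff_gen_mul (n : ℤ) (f : QSeries ω) (a : ℤ →₀ ℕ) :
    (QSeries.gen ω n * f).coeff a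
      = if a n = 0 then 0 else ω ^ a (n + 1) * f.coeff (a - Finsupp.single n 1) := by
  classical
  rw [QSeries.coeff_mul]
  split_ifs with h
  · refine Finset.sum_eq_zero ?_
    rintro ⟨x, y⟩ hxy
    rw [Finset.HasAntidiagonal.mem_antidiagonal] at hxy
    dsimp only at hxy
    have hx : x ≠ Finsupp.single n 1 := by
      rintro rfl
      rw [← hxy] at h
      simp at h
    simp [QSeries.gen, QSeries.coeff_single, hx]
  · have ha := sub_single_add h
    rw [Finset.sum_eq_single (Finsupp.single n 1, a - Finsupp.single n 1)]
    · simp [QSeries.gen, QSeries.coeff_single, cocycle_single_left]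
    · rintro ⟨x, y⟩ hxy hne
      rw [Finset.HasAntidiagonal.mem_antidiagonal] at hxy
      dsimp only at hxy
      have hx : x ≠ Finsupp.single n 1 := by
        rintro rfl
        apply hne
        rw [← hxy, add_tsub_cancel_left]
      simp [QSeries.gen, QSeries.coeff_single, hx]
    · intro hn
      exact absurd (Finset.HasAntidiagonal.mem_antidiagonal.2 ((add_comm _ _).trans ha)) hn

theorem QSeries.coeff_mul_gen (n : ℤ) (f : QSeries ω) (a : ℤ →₀ ℕ) :
    (f * QSeries.gen ω n).coeff a
      = if a n = 0 then 0 else ω ^ a (n - 1) * f.coeff (a - Finsupp.single n 1) := by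
  classical
  rw [QSeries.coeff_mul]
  split_ifs with h
  · refine Finset.sum_eq_zero ?_
    rintro ⟨x, y⟩ hxy
    rw [Finset.HasAntidiagonal.mem_antidiagonal] at hxy
    dsimp only at hxy
    have hy : y ≠ Finsupp.single n 1 := by
      rintro rfl
      rw [← hxy] at h
      simp at h
    simp [QSeries.gen, QSeries.coeff_single, hy]
  · have ha := sub_single_add h
    rw [Finset.sum_eq_single (a - Finsupp.single n 1, Finsupp.single n 1)]
    · simp [QSeries.gen, QSeries.coeff_single, cocycle_single_right]
    · rintro ⟨x, y⟩ hxy hne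
      rw [Finset.HasAntidiagonal.mem_antidiagonal] at hxy
      dsimp only at hxy
      have hy : y ≠ Finsupp.single n 1 := by
        rintro rfl
        apply hne
        rw [← hxy, add_tsub_cancel_right]
      simp [QSeries.gen, QSeries.coeff_single, hy]
    · intro hn
      exact absurd (Finset.HasAntidiagonal.mem_antidiagonal.2 ha) hn

theorem degree_sub_single {a : ℤ →₀ ℕ} {n : ℤ} (h : a n ≠ 0) :
    (a - Finsupp.single n 1).degree + 1 = a.degree := by
  conv_rhs => rw [← sub_single_add h, map_add, Finsupp.degree_single]

/-- There are too few letters to occupy all levels from `e` to `s`. -/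
theorem walkWeight_eq_zero_of_degree {s e : ℤ} {a : ℤ →₀ ℕ} (h : (a.degree : ℤ) < s + 1 - e) :
    walkWeight ω s e a = 0 := by
  rw [walkWeight, if_neg]
  intro h'
  have h1 : (Finset.Icc e s).card ≤ a.degree := by
    have hsub : Finset.Icc e s ⊆ a.support := by
      intro i hi
      rw [Finset.mem_Icc] at hi
      exact Finsupp.mem_support_iff.2 (h' i hi.1 hi.2)
    rw [Finsupp.degree_apply, Finset.card_eq_sum_ones]
    refine le_trans ?_ (Finset.sum_le_sum_of_subset hsub)
    refine Finset.sum_le_sum fun i hi => ?_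
    exact Nat.one_le_iff_ne_zero.2 (Finsupp.mem_support_iff.1 (hsub hi))
  rw [Int.card_Icc] at h1
  omega

/-- Splitting off the first factor of `L^{k+1}` is the recursion `walkWeight_step`. A path ends at
level `i + d`, so its last letter is at most `i + d + 1`; the degree condition counts the downward
steps. -/
theorem coeff_entry_lax_pow (k : ℕ) (d i : ℤ) (a : ℤ →₀ ℕ) :
    ((DiffOp.lax (QSeries.gen ω) ^ k).entry d i).coeff a
      = if 2 * (a.degree : ℤ) = k - d then walkWeight ω i (i + d + 1) a else 0 := by
  classical
  induction k generalizing d i a with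
  | zero =>
    rw [pow_zero, DiffOp.entry_one]
    rcases eq_or_ne d 0 with rfl | hd
    · rw [if_pos rfl, QSeries.coeff_one]
      by_cases ha : a = 0
      · subst ha
        simp [walkWeight_zero]
      · have : a.degree ≠ 0 := fun h => ha ((Finsupp.degree_eq_zero_iff a).1 h)
        rw [if_neg ha, if_neg (by push_cast; omega)]
    · rw [if_neg hd, QSeries.coeff_zero]
      split_ifs with h
      · push_cast at h
        rw [walkWeight_eq_zero_of_degree]
        omega
      · rfl
  | succ k ih =>
    rw [DiffOp.entry_lax_pow_succ, QSeries.coeff_add, QSeries.coeff_gen_mul, ih, ih,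
      show i + 1 + (d - 1) + 1 = i + d + 1 by ring, show i - 1 + (d + 1) + 1 = i + d + 1 by ring]
    push_cast
    by_cases ha : a = 0
    · subst ha
      simp only [map_zero, Finsupp.coe_zero, Pi.zero_apply, if_true, add_zero, walkWeight_zero]
      split_ifs <;> first | rfl | (exfalso; push_cast at *; omega)
    · rw [walkWeight_step ω i (i + d + 1) ha]
      by_cases h : 2 * (a.degree : ℤ) = k + 1 - d
      · rw [if_pos h, if_pos (by linarith)]
        congr 1
        by_cases hai : a i = 0
        · rw [if_pos hai, if_pos hai]
        · have := degree_sub_single hai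
          rw [if_neg hai, if_neg hai, if_pos (by omega)]
      · rw [if_neg h, if_neg (by intro h'; apply h; linarith), zero_add]
        by_cases hai : a i = 0
        · rw [if_pos hai]
        · have := degree_sub_single hai
          rw [if_neg hai, if_neg (by omega), mul_zero]

end Coefficients

/-! ### Multiplicities of multi-indices -/

section Multiplicities

theorem wt_apply {k : ℕ} (α : Fin k → ℤ) (i : ℤ) :
    wt α i = (Finset.univ.filter fun j => α j = i).card := by
  classical
  rw [wt, Finsupp.finsetSum_apply, Finset.card_filter]
  exact Finset.sum_congr rfl fun j _ => Finsupp.single_apply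

theorem wt_ne_zero_iff {k : ℕ} {α : Fin k → ℤ} {i : ℤ} : wt α i ≠ 0 ↔ ∃ j, α j = i := by
  rw [wt_apply, Finset.card_ne_zero]
  simp [Finset.Nonempty]

theorem wt_add_apply {k : ℕ} (α : Fin k → ℤ) (n i : ℤ) :
    wt (fun j => α j + n) (i + n) = wt α i := by
  simp [wt_apply]

theorem degree_wt {k : ℕ} (α : Fin k → ℤ) : (wt α).degree = k := by
  simp [wt]

theorem cocycle_wt {k : ℕ} (α : Fin k → ℤ) (b : ℤ →₀ ℕ) :
    cocycle (wt α) b = ∑ j, b (α j + 1) := by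
  have h : ∀ s : Finset (Fin k),
      cocycle (∑ j ∈ s, Finsupp.single (α j) 1) b = ∑ j ∈ s, b (α j + 1) := by
    classical
    intro s
    induction s using Finset.induction_on with
    | empty => simp
    | insert j s hj ih =>
      rw [Finset.sum_insert hj, Finset.sum_insert hj, cocycle_add_left, ih, cocycle_single_left,
        one_mul]
  exact h Finset.univ

theorem cocycle_wt_add {k : ℕ} (α : Fin k → ℤ) (n : ℤ) :
    cocycle (wt fun j => α j + n) (wt fun j => α j + n) = cocycle (wt α) (wt α) := by
  rw [cocycle_wt, cocycle_wt]
  refine Finset.sum_congr rfl fun j _ => ?_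
  rw [add_right_comm, wt_add_apply]

theorem Nonincreasing.add {k : ℕ} {α : Fin k → ℤ} (h : Nonincreasing α) (n : ℤ) :
    Nonincreasing fun j => α j + n := by
  intro i j hij
  have := h i j hij
  constructor <;> dsimp only <;> omega

theorem eq_of_wt_eq {k : ℕ} {α β : Fin k → ℤ} (hα : Nonincreasing α) (hβ : Nonincreasing β)
    (h : wt α = wt β) : α = β := by
  rw [← listWt_ofFn, ← listWt_ofFn] at h
  have h1 := Multiset.coe_eq_coe.1 (Multiset.toFinsupp.injective h)
  exact List.ofFn_injective (List.Perm.eq_of_pairwise (le := (· ≥ ·))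
    (fun _ _ _ _ h1 h2 => le_antisymm h2 h1) hα.pairwise hβ.pairwise h1)

theorem Nonincreasing.antitone {k : ℕ} {α : Fin k → ℤ} (h : Nonincreasing α) {i j : Fin k}
    (hij : i ≤ j) : α j ≤ α i := by
  rcases eq_or_lt_of_le hij with rfl | hlt
  · exact le_rfl
  · exact List.pairwise_ofFn.1 h.pairwise hlt

theorem Nonincreasing.le_add {k : ℕ} {α : Fin k → ℤ} (h : Nonincreasing α) (d : ℕ) (i j : Fin k)
    (hij : (i : ℕ) + d = j) : α i ≤ α j + d := by
  induction d generalizing i with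
  | zero =>
    have : i = j := Fin.ext (by simpa using hij)
    simp [this]
  | succ d ih =>
    have h1 := (h i ⟨i + 1, by have := j.2; omega⟩ rfl).2
    have h2 := ih ⟨i + 1, by have := j.2; omega⟩ (by simp only; omega)
    push_cast
    linarith

/-- Admissibility is automatic: descending to `0` by steps of at most one already bounds every
entry. -/
theorem mem_indexSet_iff {ℓ : ℕ} {α : Fin ℓ → ℤ} :
    α ∈ indexSet ℓ ↔ Nonincreasing α ∧ ∀ j : Fin ℓ, (j : ℕ) + 1 = ℓ → α j = 0 := by
  classical
  rw [indexSet, Finset.mem_filter, and_iff_right_iff_imp]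
  rintro ⟨h1, h2⟩
  rw [admissible, Finset.mem_filter, Fintype.mem_piFinset]
  refine ⟨fun j => ?_, fun i j hij => (h1 i j hij).2⟩
  have hj := j.2
  have h0 := h2 ⟨ℓ - 1, by omega⟩ (by simp only; omega)
  have h3 := h1.antitone (i := j) (j := ⟨ℓ - 1, by omega⟩)
    (by rw [Fin.le_def]; simp only; omega)
  have h4 := h1.le_add (ℓ - 1 - j) j ⟨ℓ - 1, by omega⟩ (by simp only; omega)
  rw [h0] at h3 h4
  rw [Finset.mem_Icc]
  constructor <;> omega

variable {ℓ : ℕ} {α : Fin ℓ → ℤ}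

theorem indexSet_nonneg (hα : α ∈ indexSet ℓ) (j : Fin ℓ) : 0 ≤ α j := by
  rw [mem_indexSet_iff] at hα
  have hj := j.2
  have h0 := hα.2 ⟨ℓ - 1, by omega⟩ (by simp only; omega)
  rw [← h0]
  exact hα.1.antitone (by rw [Fin.le_def]; simp only; omega)

theorem indexSet_lt (hα : α ∈ indexSet ℓ) (j : Fin ℓ) : α j < ℓ := by
  classical
  rw [indexSet, Finset.mem_filter, admissible, Finset.mem_filter, Fintype.mem_piFinset] at hα
  have := Finset.mem_Icc.1 (hα.1.1 j)
  omega

theorem wt_indexSet_zero (hℓ : 1 ≤ ℓ) (hα : α ∈ indexSet ℓ) : wt α 0 ≠ 0 :=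
  wt_ne_zero_iff.2 ⟨⟨ℓ - 1, by omega⟩, (mem_indexSet_iff.1 hα).2 _ (by simp only; omega)⟩

theorem wt_indexSet_of_neg (hα : α ∈ indexSet ℓ) {i : ℤ} (hi : i < 0) : wt α i = 0 := by
  by_contra h
  obtain ⟨j, rfl⟩ := wt_ne_zero_iff.1 h
  exact absurd (indexSet_nonneg hα j) (by omega)

theorem wt_indexSet_of_le (hα : α ∈ indexSet ℓ) {i : ℤ} (hi : ℓ ≤ i) : wt α i = 0 := by
  by_contra h
  obtain ⟨j, rfl⟩ := wt_ne_zero_iff.1 h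
  exact absurd (indexSet_lt hα j) (by omega)

theorem wt_indexSet_interval (hα : α ∈ indexSet ℓ) {i m : ℤ} (hi : 0 ≤ i) (him : i ≤ m)
    (hm : wt α m ≠ 0) : wt α i ≠ 0 := by
  obtain ⟨j, rfl⟩ := wt_ne_zero_iff.1 hm
  rw [mem_indexSet_iff] at hα
  have key : ∀ d : ℕ, ∀ j : Fin ℓ, (j : ℕ) + d + 1 = ℓ → i ≤ α j → ∃ j', α j' = i := by
    intro d
    induction d with
    | zero =>
      intro j hj hij
      exact ⟨j, le_antisymm (by rw [hα.2 j (by omega)]; exact hi) hij⟩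
    | succ d ih =>
      intro j hj hij
      rcases eq_or_lt_of_le hij with h | h
      · exact ⟨j, h.symm⟩
      · have h1 := (hα.1 j ⟨j + 1, by omega⟩ rfl).2
        exact ih ⟨j + 1, by omega⟩ (by simp only; omega) (by omega)
  rw [wt_ne_zero_iff]
  exact key (ℓ - 1 - j) j (by have := j.2; omega) him

/-- The translation is the lowest occupied level, and a nonincreasing word is determined by its
multiplicities. Thus the monomials of the Hamiltonian do not repeat. -/
theorem indexSet_ext {β : Fin ℓ → ℤ} {k k' : ℤ} (hℓ : 1 ≤ ℓ) (hα : α ∈ indexSet ℓ)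
    (hβ : β ∈ indexSet ℓ) (h : wt (fun j => α j + k) = wt fun j => β j + k') :
    α = β ∧ k = k' := by
  have key : ∀ {α β : Fin ℓ → ℤ} {k k' : ℤ}, α ∈ indexSet ℓ → β ∈ indexSet ℓ →
      wt (fun j => α j + k) = wt (fun j => β j + k') → k' ≤ k := by
    intro α β k k' hα hβ h
    have h1 := wt_indexSet_zero hℓ hα
    rw [← wt_add_apply α k, zero_add, h, wt_ne_zero_iff] at h1
    obtain ⟨j, hj⟩ := h1
    have := indexSet_nonneg hβ j
    omega
  obtain rfl : k = k' := le_antisymm (key hβ hα h.symm) (key hα hβ h)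
  refine ⟨?_, rfl⟩
  have h2 := eq_of_wt_eq ((mem_indexSet_iff.1 hα).1.add k) ((mem_indexSet_iff.1 hβ).1.add k) h
  funext j
  exact add_right_cancel (congrFun h2 j)

/-- A nonempty interval of occupied levels carries a shifted element of the index set. -/
theorem exists_indexSet (hℓ : 1 ≤ ℓ) {a : ℤ →₀ ℕ} (hdeg : a.degree = ℓ)
    (hint : ∀ i j m, i ≤ j → j ≤ m → a i ≠ 0 → a m ≠ 0 → a j ≠ 0) :
    ∃ α ∈ indexSet ℓ, ∃ k : ℤ, wt (fun j => α j + k) = a := by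
  set L := (Finsupp.toMultiset a).sort (· ≥ ·) with hL
  have hsort : L.Pairwise (· ≥ ·) := Multiset.pairwise_sort _ _
  have hmem : ∀ i, i ∈ L ↔ a i ≠ 0 := by
    intro i
    rw [hL, Multiset.mem_sort, Finsupp.mem_toMultiset, Finsupp.mem_support_iff]
  have hlen : L.length = ℓ := by
    rw [hL, Multiset.length_sort, Finsupp.card_toMultiset, ← hdeg]
    rfl
  clear_value L
  subst hlen
  have hwt : wt (fun j => L.get j) = a := by
    rw [← listWt_ofFn, List.ofFn_get, listWt, hL]
    simp
  have hmono : ∀ i j : Fin L.length, i ≤ j → L.get j ≤ L.get i := by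
    intro i j hij
    rcases eq_or_lt_of_le hij with rfl | h
    · exact le_rfl
    · exact List.pairwise_iff_get.1 hsort i j h
  set last : Fin L.length := ⟨L.length - 1, by omega⟩ with hlast
  refine ⟨fun j => L.get j - L.get last, ?_, L.get last, by simpa using hwt⟩
  rw [mem_indexSet_iff]
  refine ⟨fun i j hij => ?_, fun j hj => ?_⟩
  · have h1 := hmono i j (by rw [Fin.le_def]; omega)
    refine ⟨by dsimp only; omega, ?_⟩
    by_contra hlt
    dsimp only at hlt
    -- A jump by more than one would leave an occupied level strictly between two adjacent letters
    -- of a sorted list.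
    have h2 : a (L.get j + 1) ≠ 0 := hint (L.get j) _ (L.get i) (by omega) (by omega)
      ((hmem _).1 (List.get_mem L j)) ((hmem _).1 (List.get_mem L i))
    obtain ⟨m, hm⟩ := List.mem_iff_get.1 ((hmem _).2 h2)
    rcases le_or_gt m i with h | h
    · have := hmono m i h
      omega
    · have := hmono j m (by rw [Fin.le_def]; rw [Fin.lt_def] at h; omega)
      omega
  · have : j = last := Fin.ext (by rw [hlast]; simp only; omega)
    rw [this, sub_self]

end Multiplicities

/-! ### Weights of words that start and end around one level -/

section DiagonalWeight

variable {R : Type*} [CommRing R] (ω : R)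

theorem walkWeight_add {s e n : ℤ} {a b : ℤ →₀ ℕ} (h : ∀ i, b (i + n) = a i) :
    walkWeight ω (s + n) (e + n) b = walkWeight ω s e a := by
  simp only [walkWeight]
  have h1 : (∀ i, e + n ≤ i → i ≤ s + n → b i ≠ 0) ↔ ∀ i, e ≤ i → i ≤ s → a i ≠ 0 := by
    constructor
    · intro H i h1 h2
      rw [← h]
      exact H (i + n) (by omega) (by omega)
    · intro H i h1 h2
      have := H (i - n) (by omega) (by omega)
      rwa [← h, sub_add_cancel] at this
  have h2 : ∏ᶠ i, bond ω (s + n) (e + n) b i = ∏ᶠ i, bond ω s e a i := by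
    rw [← finprod_comp_equiv (Equiv.addRight n)]
    refine finprod_congr fun i => ?_
    simp only [Equiv.coe_addRight, bond, add_le_add_iff_right, h, add_right_comm i n 1]
  simp only [h1, h2]

theorem walkWeight_self_eq_zero {k : ℤ} {a : ℤ →₀ ℕ} (h : a k = 0) :
    walkWeight ω k k a = 0 := by
  rw [walkWeight, if_neg fun h' => h' k le_rfl le_rfl h]

theorem walkWeight_self {k : ℤ} {a : ℤ →₀ ℕ} (h : a k ≠ 0) :
    walkWeight ω k k a = ∏ᶠ i, bond ω k k a i := by
  rw [walkWeight, if_pos]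
  intro i h1 h2
  rwa [le_antisymm h2 h1]

/-- Only the bond `k` sees the change of base level, and there it is `qBinom_exchange`. If one of
the two levels is empty, both sides vanish. -/
theorem walkWeight_exchange (k : ℤ) (a : ℤ →₀ ℕ) :
    (ω ^ a (k + 1) - 1) * walkWeight ω k k a
      = (ω ^ a k - 1) * walkWeight ω (k + 1) (k + 1) a := by
  classical
  by_cases h0 : a k = 0
  · rw [walkWeight_self_eq_zero ω h0, h0]
    simp
  by_cases h1 : a (k + 1) = 0
  · rw [walkWeight_self_eq_zero ω h1, h1]
    simp
  have hJ : ∀ i, i ∉ insert k (bondSupport a) → a i = 0 ∧ a (i + 1) = 0 := fun i hi =>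
    eq_zero_of_notMem_bondSupport fun h => hi (Finset.mem_insert_of_mem h)
  rw [walkWeight_self ω h0, walkWeight_self ω h1, finprod_bond_eq_prod ω _ _ _ hJ,
    finprod_bond_eq_prod ω _ _ _ hJ, ← Finset.mul_prod_erase _ _ (Finset.mem_insert_self k _),
    ← Finset.mul_prod_erase _ (bond ω (k + 1) (k + 1) a) (Finset.mem_insert_self k _),
    ← mul_assoc, ← mul_assoc]
  congr 1
  · simp only [bond]
    rw [if_pos le_rfl, if_pos le_rfl, if_neg (by omega), if_neg (by omega)]
    exact qBinom_exchange ω _ _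
  · refine Finset.prod_congr rfl fun i hi => ?_
    have hik := Finset.ne_of_mem_erase hi
    have : k ≤ i ↔ k + 1 ≤ i := by omega
    simp only [bond, this]

theorem interval_of_walkWeight_ne_zero {k : ℤ} {a : ℤ →₀ ℕ} (h : walkWeight ω k k a ≠ 0)
    {i j m : ℤ} (hij : i ≤ j) (hjm : j ≤ m) (hi : a i ≠ 0) (hm : a m ≠ 0) : a j ≠ 0 := by
  have hk : a k ≠ 0 := fun h0 => h (walkWeight_self_eq_zero ω h0)
  rw [walkWeight_self ω hk] at h
  have hb : ∀ i, bond ω k k a i ≠ 0 := fun i h0 => h (finprod_bond_eq_zero ω h0)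
  rcases le_total k j with hkj | hkj
  · refine ne_zero_of_bond_above ω (fun i _ => hb i) hkj hkj (n := (m - j).toNat) ?_
    rwa [Int.toNat_of_nonneg (by omega), add_sub_cancel]
  · refine ne_zero_of_bond_below ω (fun i _ => hb i) hkj hkj (n := (j - i).toNat) ?_
    rwa [Int.toNat_of_nonneg (by omega), sub_sub_cancel]

theorem map_walkWeight {S : Type*} [CommRing S] (f : R →+* S) (s e : ℤ) (a : ℤ →₀ ℕ) :
    f (walkWeight ω s e a) = walkWeight (f ω) s e a := by
  simp only [walkWeight]
  split_ifs
  · rw [finprod_bond_eq_prod ω _ _ _ fun i hi => eq_zero_of_notMem_bondSupport hi,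
      finprod_bond_eq_prod (f ω) _ _ _ fun i hi => eq_zero_of_notMem_bondSupport hi, map_prod]
    refine Finset.prod_congr rfl fun i _ => ?_
    simp only [bond]
    split_ifs <;> exact map_qBinom ω f _ _
  · exact map_zero f

theorem shift_zero_apply (x : FreeAlgebra R ℤ) : shift 0 x = x := by
  have h : shift (R := R) 0 = AlgHom.id R _ := by
    apply FreeAlgebra.hom_ext
    funext n
    simp [shift, u]
  rw [h]
  rfl

theorem freeToSeries_shift_Xpoly {ℓ : ℕ} (hℓ : 1 ≤ ℓ) (n : ℤ) :
    freeToSeries ω (shift n (Xpoly R ℓ))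
      = (DiffOp.lax (QSeries.gen ω) ^ (2 * ℓ - 1)).entry (-1) n := by
  rw [map_shift_Xpoly _ hℓ]
  simp only [freeToSeries_u]
  rfl

theorem coeff_entry_lax_pow_neg_one {ℓ : ℕ} (hℓ : 1 ≤ ℓ) (n : ℤ) (a : ℤ →₀ ℕ) :
    ((DiffOp.lax (QSeries.gen ω) ^ (2 * ℓ - 1)).entry (-1) n).coeff a
      = if a.degree = ℓ then walkWeight ω n n a else 0 := by
  rw [coeff_entry_lax_pow, neg_add_cancel_right]
  congr 1
  simp only [eq_iff_iff]
  omega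

end DiagonalWeight

/-! ### The coefficients of the Hamiltonians -/

section HamCoeff

variable {ℓ : ℕ} {α : Fin ℓ → ℤ}

/-- Admissible words not similar to `α` have another exponent, so `P α` can be read off from the
whole of `X^{(ℓ)}`. -/
theorem P_eq_walkWeight (hℓ : 1 ≤ ℓ) (α : Fin ℓ → ℤ) : P α = walkWeight X 0 0 (wt α) := by
  classical
  have h := coeff_entry_lax_pow_neg_one (X : ℤ[X]) hℓ 0 (wt α)
  rw [if_pos (degree_wt α), ← freeToSeries_shift_Xpoly _ hℓ, shift_zero_apply] at h
  rw [← h, P, toSeries_proj, similarSum, Xpoly]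
  let ev : QSeries (X : ℤ[X]) →+ ℤ[X] :=
    { toFun := fun f => f.coeff (wt α), map_zero' := rfl, map_add' := fun _ _ => rfl }
  change ev _ = ev _
  rw [map_sum, map_sum, map_sum, map_sum]
  refine Finset.sum_subset (Finset.filter_subset _ _) fun β hβ hβ' => ?_
  have hne : wt α ≠ wt β := fun h' => hβ' (Finset.mem_filter.2 ⟨hβ, h'.symm⟩)
  obtain ⟨c, hc⟩ := freeToSeries_list (X : ℤ[X]) (List.ofFn β)
  rw [word_eq, hc, listWt_ofFn]
  simp [ev, QSeries.coeff_single, hne]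

/-- Bonds below level `0` are `1`, as are those from the top level on, so the range `ℓ` gives the
same product as `0 ≤ i < α_1`. -/
theorem P_eq_prod_qBinom (hℓ : 1 ≤ ℓ) (hα : α ∈ indexSet ℓ) :
    P α = ∏ i ∈ Finset.range ℓ,
      qBinom X (wt α ((i : ℤ) + 1) + wt α (i : ℤ) - 1) (wt α ((i : ℤ) + 1)) := by
  rw [P_eq_walkWeight hℓ, walkWeight_self _ (wt_indexSet_zero hℓ hα),
    finprod_eq_prod_of_mulSupport_subset _ (s := (Finset.range ℓ).map Nat.castEmbedding)]
  · rw [Finset.prod_map]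
    refine Finset.prod_congr rfl fun i _ => ?_
    rw [bond, Nat.castEmbedding_apply, if_pos (by omega), if_pos (by omega), add_comm (wt α _)]
  · intro i hi
    by_contra hn
    apply hi
    simp only [Finset.coe_map, Finset.coe_range, Set.mem_image, Set.mem_Iio,
      Nat.castEmbedding_apply, not_exists, not_and] at hn
    rcases lt_or_ge i 0 with h | h
    · rw [bond, if_neg (by omega), if_neg (by omega), wt_indexSet_of_neg hα h, qBinom_zero_right]
    · have h1 : (ℓ : ℤ) ≤ i := by
        by_contra hlt
        exact hn i.toNat (by omega) (Int.toNat_of_nonneg h)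
      exact bond_eq_one _ (wt_indexSet_of_le hα h1) (wt_indexSet_of_le hα (by omega))

theorem X_pow_sub_one_ne_zero {m : ℕ} (hm : m ≠ 0) : (X ^ m - 1 : ℤ[X]) ≠ 0 := by
  simpa using X_pow_sub_C_ne_zero (Nat.pos_of_ne_zero hm) (1 : ℤ)

theorem P_mul_eq (hℓ : 1 ≤ ℓ) (hα : α ∈ indexSet ℓ) (k : ℤ) :
    (X ^ wt α 0 - 1) * walkWeight X k k (wt α) = (X ^ wt α k - 1) * P α := by
  by_cases hk : wt α k = 0
  · rw [hk, walkWeight_self_eq_zero _ hk]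
    simp
  have hk0 : 0 ≤ k := by
    by_contra h
    exact hk (wt_indexSet_of_neg hα (by omega))
  obtain ⟨n, rfl⟩ := Int.eq_ofNat_of_zero_le hk0
  clear hk0
  induction n with
  | zero => rw [P_eq_walkWeight hℓ]; rfl
  | succ n ih =>
    push_cast at hk ⊢
    have hn : wt α n ≠ 0 := wt_indexSet_interval hα (by omega) (by omega) hk
    -- Climbing one level divides by `X^{a_n} - 1`, which is nonzero because the levels below an
    -- occupied one are occupied.
    apply mul_left_cancel₀ (X_pow_sub_one_ne_zero hn)
    linear_combination (X ^ wt α (n + 1) - 1) * ih hn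
      - (X ^ wt α 0 - 1) * walkWeight_exchange (X : ℤ[X]) n (wt α)

/-- `X^ℓ - 1` telescopes into multiples of the `X^{a_i} - 1`, and each `P α * (X^{a_i} - 1)` is
divisible by `P_mul_eq`. -/
theorem dvd_P_mul (hℓ : 1 ≤ ℓ) (hα : α ∈ indexSet ℓ) :
    (X ^ wt α 0 - 1 : ℤ[X]) ∣ P α * (X ^ ℓ - 1) := by
  classical
  have h : ∀ s : Finset ℤ, (X ^ wt α 0 - 1 : ℤ[X]) ∣ P α * (X ^ (∑ i ∈ s, wt α i) - 1) := by
    intro s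
    induction s using Finset.induction_on with
    | empty => simp
    | insert i s hi ih =>
      rw [Finset.sum_insert hi]
      have h1 : P α * (X ^ (wt α i + ∑ j ∈ s, wt α j) - 1)
          = X ^ wt α i * (P α * (X ^ (∑ j ∈ s, wt α j) - 1)) + (X ^ wt α i - 1) * P α := by
        rw [pow_add]; ring
      rw [h1, ← P_mul_eq hℓ hα]
      exact dvd_add (dvd_mul_of_dvd_right ih _) (dvd_mul_right _ _)
  have h2 := h (wt α).support
  rwa [← Finsupp.degree_apply, degree_wt] at h2

theorem hamCoeff_mul (hℓ : 1 ≤ ℓ) (hα : α ∈ indexSet ℓ) :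
    hamCoeff α * (X ^ wt α 0 - 1) = P α * (X ^ ℓ - 1) := by
  obtain ⟨c, hc⟩ := dvd_P_mul hℓ hα
  have hm : (X ^ wt α 0 - 1 : ℤ[X]).Monic := by
    simpa using monic_X_pow_sub_C (1 : ℤ) (wt_indexSet_zero hℓ hα)
  rw [hamCoeff, hc, mul_divByMonic_cancel_left _ hm, mul_comm]

/-- The level `0` in the definition of the coefficient plays no special role; this symmetry produces
the Heisenberg form. -/
theorem hamCoeff_mul_level (hℓ : 1 ≤ ℓ) (hα : α ∈ indexSet ℓ) (k : ℤ) :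
    hamCoeff α * (X ^ wt α k - 1) = (X ^ ℓ - 1) * walkWeight X k k (wt α) := by
  apply mul_left_cancel₀ (X_pow_sub_one_ne_zero (wt_indexSet_zero hℓ hα))
  linear_combination (X ^ wt α k - 1) * hamCoeff_mul hℓ hα
    - (X ^ ℓ - 1) * P_mul_eq hℓ hα k

theorem sum_wt_eq {M : Type*} [AddCommMonoid M] (hα : α ∈ indexSet ℓ) (f : ℤ → ℕ → M)
    (hf : ∀ i, f i 0 = 0) : (wt α).sum f = ∑ i ∈ Finset.range ℓ, f i (wt α i) := by
  rw [Finsupp.sum_of_support_subset (s := (Finset.range ℓ).map Nat.castEmbedding) _ _ _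
    fun i _ => hf i, Finset.sum_map]
  · rfl
  · intro i hi
    obtain ⟨j, rfl⟩ := wt_ne_zero_iff.1 (Finsupp.mem_support_iff.1 hi)
    have h1 := indexSet_nonneg hα j
    have h2 := indexSet_lt hα j
    simp only [Finset.mem_map, Finset.mem_range, Nat.castEmbedding_apply]
    exact ⟨(α j).toNat, by omega, Int.toNat_of_nonneg h1⟩

/-- The binomials have total degree `∑ a_{i+1}(a_i - 1)`, and the quotient adds `ℓ - a_0 = ∑
a_{i+1}`. The sum is `∑ a_i a_{i+1}`, the exponent in the Hermitian conjugation. -/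
theorem palindromic_hamCoeff (hℓ : 1 ≤ ℓ) (hα : α ∈ indexSet ℓ) :
    Palindromic (cocycle (wt α) (wt α)) (hamCoeff α) := by
  have hzero : ∀ i : ℕ, wt α (i : ℤ) = 0 → wt α ((i : ℤ) + 1) = 0 := by
    intro i h
    by_contra h'
    exact wt_indexSet_interval hα (by omega) (by omega) h' h
  have hP : Palindromic (∑ i ∈ Finset.range ℓ, wt α ((i : ℤ) + 1) * (wt α (i : ℤ) - 1)) (P α) := by
    rw [P_eq_prod_qBinom hℓ hα]
    refine Palindromic.prod _ _ _ fun i _ => ?_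
    by_cases h : wt α (i : ℤ) = 0
    · rw [h, hzero i h]
      simpa using Palindromic.one
    · rw [show wt α ((i : ℤ) + 1) + wt α (i : ℤ) - 1
        = wt α ((i : ℤ) + 1) + (wt α (i : ℤ) - 1) by omega]
      exact Palindromic.qBinom _ _
  refine Palindromic.of_mul_eq (wt_indexSet_zero hℓ hα) hP ?_ (hamCoeff_mul hℓ hα)
  have h1 : cocycle (wt α) (wt α) = ∑ i ∈ Finset.range ℓ, wt α (i : ℤ) * wt α ((i : ℤ) + 1) :=
    sum_wt_eq hα (fun n x => x * wt α (n + 1)) fun _ => zero_mul _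
  have h2 : ℓ = ∑ i ∈ Finset.range ℓ, wt α (i : ℤ) :=
    (degree_wt α).symm.trans (sum_wt_eq hα (fun _ x => x) fun _ => rfl)
  have h3 : ∑ i ∈ Finset.range ℓ, wt α (i : ℤ)
      = ∑ i ∈ Finset.range ℓ, wt α ((i : ℤ) + 1) + wt α 0 := by
    have h4 := Finset.sum_range_succ' (fun i : ℕ => wt α (i : ℤ)) ℓ
    rw [Finset.sum_range_succ, wt_indexSet_of_le hα le_rfl, add_zero] at h4
    push_cast at h4
    exact h4
  have h5 : ∑ i ∈ Finset.range ℓ, wt α (i : ℤ) * wt α ((i : ℤ) + 1)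
      = ∑ i ∈ Finset.range ℓ, wt α ((i : ℤ) + 1) * (wt α (i : ℤ) - 1)
        + ∑ i ∈ Finset.range ℓ, wt α ((i : ℤ) + 1) := by
    rw [← Finset.sum_add_distrib]
    refine Finset.sum_congr rfl fun i _ => ?_
    by_cases h : wt α (i : ℤ) = 0
    · rw [h, hzero i h]
    · obtain ⟨x, hx⟩ := Nat.exists_eq_succ_of_ne_zero h
      rw [hx, Nat.succ_sub_one, Nat.succ_eq_add_one]
      ring
  omega

/-- The coefficient of the Hamiltonian at an arbitrary normally ordered monomial. -/
def hamWeight (ℓ : ℕ) (a : ℤ →₀ ℕ) : ℤ[X] :=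
  open Classical in
  if h : ∃ α ∈ indexSet ℓ, ∃ k : ℤ, wt (fun j => α j + k) = a then hamCoeff h.choose else 0

theorem hamWeight_wt (hℓ : 1 ≤ ℓ) (hα : α ∈ indexSet ℓ) (k : ℤ) :
    hamWeight ℓ (wt fun j => α j + k) = hamCoeff α := by
  have h : ∃ β ∈ indexSet ℓ, ∃ n : ℤ, wt (fun j => β j + n) = wt fun j => α j + k :=
    ⟨α, hα, k, rfl⟩
  rw [hamWeight, dif_pos h]
  obtain ⟨hβ, n, hn⟩ := h.choose_spec
  rw [(indexSet_ext hℓ hβ hα hn).1]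

/-- An exponent of degree `ℓ` outside the translated index set has a gap between occupied levels, so
its weights vanish. -/
theorem hamWeight_mul_level (hℓ : 1 ≤ ℓ) (a : ℤ →₀ ℕ) (k : ℤ) :
    hamWeight ℓ a * (X ^ a k - 1)
      = (X ^ ℓ - 1) * if a.degree = ℓ then walkWeight X k k a else 0 := by
  by_cases h : ∃ α ∈ indexSet ℓ, ∃ n : ℤ, wt (fun j => α j + n) = a
  · obtain ⟨α, hα, n, rfl⟩ := h
    rw [hamWeight_wt hℓ hα, if_pos (degree_wt _)]
    have h1 := hamCoeff_mul_level hℓ hα (k - n)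
    rw [← wt_add_apply α n, sub_add_cancel] at h1
    rw [h1, ← walkWeight_add X (wt_add_apply α n), sub_add_cancel]
  · rw [hamWeight, dif_neg h, zero_mul, eq_comm]
    split_ifs with hdeg
    · refine mul_eq_zero_of_right _ ?_
      by_contra hne
      exact h (exists_indexSet hℓ hdeg fun i j m h1 h2 h3 h4 =>
        interval_of_walkWeight_ne_zero X hne h1 h2 h3 h4)
    · exact mul_zero _

theorem coeff_hamiltonian (ω : ℂ) (hℓ : 1 ≤ ℓ) (a : ℤ →₀ ℕ) :
    (hamiltonian ω ℓ).coeff a = aeval ω (hamWeight ℓ a) := by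
  classical
  let ev : QSeries ω →+ ℂ :=
    { toFun := fun f => f.coeff a, map_zero' := rfl, map_add' := fun _ _ => rfl }
  change ev _ = _
  rw [hamiltonian, map_sum]
  have hterm : ∀ α ∈ indexSet ℓ, ev (QSeries.formalSum fun k : ℤ =>
      aeval ω (hamCoeff α) • toSeries ω (proj ω (word ℂ fun j => α j + k)))
      = ∑ᶠ k : ℤ, if wt (fun j => α j + k) = a then aeval ω (hamCoeff α) else 0 := by
    intro α hα
    refine finsum_congr fun k => ?_
    dsimp only
    rw [toSeries_proj, word_eq,
      freeToSeries_sorted _ _ ((mem_indexSet_iff.1 hα).1.add k).pairwise, listWt_ofFn,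
      QSeries.coeff_smul, QSeries.coeff_single]
    simp [eq_comm]
  rw [Finset.sum_congr rfl hterm]
  by_cases h : ∃ α ∈ indexSet ℓ, ∃ n : ℤ, wt (fun j => α j + n) = a
  · obtain ⟨α, hα, n, rfl⟩ := h
    rw [hamWeight_wt hℓ hα, Finset.sum_eq_single α, finsum_eq_single _ n, if_pos rfl]
    · intro k hk
      rw [if_neg fun h => hk (indexSet_ext hℓ hα hα h).2]
    · intro β hβ hne
      rw [finsum_eq_zero_of_forall_eq_zero]
      intro k
      rw [if_neg fun h => hne (indexSet_ext hℓ hβ hα h).1]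
    · intro hn
      exact absurd hα hn
  · rw [hamWeight, dif_neg h, map_zero]
    refine Finset.sum_eq_zero fun β hβ => finsum_eq_zero_of_forall_eq_zero fun k => ?_
    rw [if_neg fun h' => h ⟨β, hβ, k, h'⟩]

end HamCoeff

/-! ### The zero curvature equation -/

section ZeroCurvature

/-- Two derivations in Lax form with respect to commuting operators commute on the Lax operator. -/
theorem lie_lie_eq_zero_of_lax {E : Type*} [Ring E] (π : E →+ E)
    (hpos : ∀ x y, π (π x * π y) = π x * π y)
    (hneg : ∀ x y, π ((x - π x) * (y - π y)) = 0) {H₁ H₂ x₁ x₂ L : E}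
    (hH₁ : ∀ x, π ⁅H₁, x⁆ = ⁅H₁, π x⁆) (hH₂ : ∀ x, π ⁅H₂, x⁆ = ⁅H₂, π x⁆)
    (hx : Commute x₁ x₂) (h₁ : ⁅H₁, L⁆ = ⁅π x₁, L⁆) (h₂ : ⁅H₂, L⁆ = ⁅π x₂, L⁆)
    (h₁₂ : ⁅H₁, x₂⁆ = ⁅π x₁, x₂⁆) (h₂₁ : ⁅H₂, x₁⁆ = ⁅π x₂, x₁⁆) : ⁅⁅H₁, H₂⁆, L⁆ = 0 := by
  have hcurv : ⁅H₁, π x₂⁆ - ⁅H₂, π x₁⁆ = ⁅π x₁, π x₂⁆ := by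
    rw [← hH₁, ← hH₂, h₁₂, h₂₁, ← map_sub]
    -- With `x = x₊ + x₋` and `x₊ = π x`, this is `[x₁₊,x₂₊] - [x₁₋,x₂₋] + [x₁,x₂]`: `π` fixes the
    -- first term and kills the second, and the third is zero.
    have h : ⁅π x₁, x₂⁆ - ⁅π x₂, x₁⁆ = (π x₁ * π x₂ - π x₂ * π x₁)
        - ((x₁ - π x₁) * (x₂ - π x₂) - (x₂ - π x₂) * (x₁ - π x₁)) + (x₁ * x₂ - x₂ * x₁) := by
      simp only [Ring.lie_def]
      noncomm_ring
    rw [hx.eq, sub_self, add_zero] at h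
    rw [h, map_sub, map_sub, map_sub, hpos, hpos, hneg, hneg, sub_zero, sub_zero, Ring.lie_def]
  have hjac : ⁅⁅H₁, H₂⁆, L⁆ = ⁅H₁, ⁅H₂, L⁆⁆ - ⁅H₂, ⁅H₁, L⁆⁆ := by
    simp only [Ring.lie_def]
    noncomm_ring
  have hexp : ⁅H₁, ⁅π x₂, L⁆⁆ - ⁅H₂, ⁅π x₁, L⁆⁆
      = ⁅⁅H₁, π x₂⁆ - ⁅H₂, π x₁⁆, L⁆ + ⁅π x₂, ⁅H₁, L⁆⁆ - ⁅π x₁, ⁅H₂, L⁆⁆ := by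
    simp only [Ring.lie_def]
    noncomm_ring
  rw [hjac, h₁, h₂, hexp, h₁, h₂, hcurv]
  simp only [Ring.lie_def]
  noncomm_ring

namespace DiffOp

variable {A : Type*} [Ring A]

/-- The operator of left multiplication by a constant. -/
def const (c : A) : DiffOp A :=
  SkewMonoidAlgebra.single (Multiplicative.ofAdd 0) (show LevelSeq A from fun _ => c)

theorem entry_const (c : A) (d i : ℤ) : (const c).entry d i = if d = 0 then c else 0 := by
  rw [const, entry_single]
  simp only [eq_comm]

theorem entry_const_mul (c : A) (f : DiffOp A) (d i : ℤ) :
    (const c * f).entry d i = c * f.entry d i := by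
  rw [const, entry_single_mul, sub_zero, add_zero]

theorem entry_mul_const (c : A) (f : DiffOp A) (d i : ℤ) :
    (f * const c).entry d i = f.entry d i * c := by
  rw [const, entry_mul_single, sub_zero]

theorem const_lie (b c : A) : const ⁅b, c⁆ = ⁅const b, const c⁆ := by
  apply ext_entry
  intro d i
  rw [Ring.lie_def, Ring.lie_def, entry_sub, entry_const_mul, entry_const_mul, entry_const,
    entry_const, entry_const]
  split_ifs <;> simp

/-- The part of a difference operator of nonnegative degree. -/
def nonnegPart : DiffOp A →+ DiffOp A where
  toFun f := SkewMonoidAlgebra.ofCoeff (f.coeff.filter fun x => 0 ≤ x.toAdd)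
  map_zero' := by
    apply ext_entry
    intro d i
    change (Finsupp.filter _ (0 : Multiplicative ℤ →₀ LevelSeq A)) _ i = 0
    rw [Finsupp.filter_zero]
    rfl
  map_add' f g := by
    apply ext_entry
    intro d i
    rw [entry_add]
    simp only [entry, SkewMonoidAlgebra.coeff_add, Finsupp.filter_add]
    rfl

theorem entry_nonnegPart (f : DiffOp A) (d i : ℤ) :
    (nonnegPart f).entry d i = if 0 ≤ d then f.entry d i else 0 := by
  change (Finsupp.filter _ f.coeff) _ i = _
  rw [Finsupp.filter_apply]
  simp only [toAdd_ofAdd]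
  split_ifs <;> rfl

theorem entry_mul_eq_zero {f g : DiffOp A} {d : ℤ}
    (h : ∀ m, (∀ i, f.entry m i = 0) ∨ ∀ i, g.entry (d - m) i = 0) (i : ℤ) :
    (f * g).entry d i = 0 := by
  rw [entry, SkewMonoidAlgebra.coeff_mul_left, SkewMonoidAlgebra.sum_def', Finset.sum_eq_zero]
  · rfl
  · intro x _
    rcases h x.toAdd with h | h
    · have : f.coeff x = 0 := funext h
      rw [this, zero_mul]
    · have : g.coeff (x⁻¹ * Multiplicative.ofAdd d) = 0 := by
        rw [mul_comm]
        exact funext h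
      rw [this, smul_zero, mul_zero]

theorem nonnegPart_mul_nonnegPart (x y : DiffOp A) :
    nonnegPart (nonnegPart x * nonnegPart y) = nonnegPart x * nonnegPart y := by
  apply ext_entry
  intro d i
  rw [entry_nonnegPart]
  split_ifs with hd
  · rfl
  · rw [entry_mul_eq_zero]
    intro m
    simp only [entry_nonnegPart]
    rcases lt_or_ge m 0 with hm | hm
    · left; intro i; rw [if_neg (by omega)]
    · right; intro i; rw [if_neg (by omega)]

theorem nonnegPart_negPart_mul_negPart (x y : DiffOp A) :
    nonnegPart ((x - nonnegPart x) * (y - nonnegPart y)) = 0 := by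
  apply ext_entry
  intro d i
  rw [entry_nonnegPart, entry_zero]
  split_ifs with hd
  · rw [entry_mul_eq_zero]
    intro m
    simp only [entry_sub, entry_nonnegPart]
    rcases lt_or_ge m 0 with hm | hm
    · right; intro i; rw [if_pos (by omega), sub_self]
    · left; intro i; rw [if_pos (by omega), sub_self]
  · rfl

theorem nonnegPart_const_lie (c : A) (x : DiffOp A) :
    nonnegPart ⁅const c, x⁆ = ⁅const c, nonnegPart x⁆ := by
  apply ext_entry
  intro d i
  rw [entry_nonnegPart, Ring.lie_def, Ring.lie_def, entry_sub, entry_sub, entry_const_mul,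
    entry_const_mul, entry_mul_const, entry_mul_const, entry_nonnegPart]
  split_ifs <;> simp

theorem commute_const {c : A} (hc : ∀ a, Commute c a) (x : DiffOp A) : Commute (const c) x := by
  apply ext_entry
  intro d i
  rw [entry_const_mul, entry_mul_const]
  exact hc _

variable (u : ℤ → A)

/-- Split off `L` on the left at level `i` and on the right at level `i - 1`: the terms with the
coefficient of `S` cancel. This replaces the flow by the diagonal of `L^{2ℓ}`. -/
theorem entry_lax_pow_two_mul (ℓ : ℕ) (hℓ : 1 ≤ ℓ) (i : ℤ) :
    (lax u ^ (2 * ℓ)).entry 0 i * u i - u i * (lax u ^ (2 * ℓ)).entry 0 (i - 1)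
      = (lax u ^ (2 * ℓ - 1)).entry (-1) (i + 1) * u i
        - u i * (lax u ^ (2 * ℓ - 1)).entry (-1) (i - 1) := by
  have h1 := entry_lax_mul u (lax u ^ (2 * ℓ - 1)) 0 i
  have h2 := entry_mul_lax u (lax u ^ (2 * ℓ - 1)) 0 (i - 1)
  rw [← pow_succ', show 2 * ℓ - 1 + 1 = 2 * ℓ by omega] at h1
  rw [← pow_succ, show 2 * ℓ - 1 + 1 = 2 * ℓ by omega] at h2
  rw [h1, h2]
  simp only [zero_sub, zero_add, add_zero, sub_add_cancel]
  noncomm_ring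

/-- A constant whose commutators with the `u_i` are those of the Volterra hierarchy acts in
Lax form. -/
theorem const_lie_lax {ℓ : ℕ} (hℓ : 1 ≤ ℓ) {κ H : A} (hκ : ∀ a, Commute κ a)
    (h : ∀ i, ⁅H, u i⁆ = κ * ((lax u ^ (2 * ℓ - 1)).entry (-1) (i + 1) * u i
        - u i * (lax u ^ (2 * ℓ - 1)).entry (-1) (i - 1))) :
    ⁅const H, lax u⁆ = ⁅nonnegPart (const κ * lax u ^ (2 * ℓ)), lax u⁆ := by
  apply ext_entry
  intro d i
  have hcomm : (lax u ^ (2 * ℓ) * lax u).entry d i = (lax u * lax u ^ (2 * ℓ)).entry d i := by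
    rw [← pow_succ, ← pow_succ']
  rw [entry_mul_lax, entry_lax_mul] at hcomm
  simp only [Ring.lie_def, entry_sub, entry_mul_lax, entry_lax_mul, entry_nonnegPart,
    entry_const_mul, entry_const]
  rcases lt_trichotomy d (-1) with hd | rfl | hd
  · have a1 : ¬ d - 1 = 0 := by omega
    have a2 : ¬ d + 1 = 0 := by omega
    have a3 : ¬ 0 ≤ d - 1 := by omega
    have a4 : ¬ 0 ≤ d + 1 := by omega
    simp only [a1, a2, a3, a4, if_false, zero_mul, mul_zero, add_zero]
  -- In degree `-1` the nonnegative part contributes only its diagonal, giving the hypothesis on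
  -- `[H, u_i]`.
  · have h1 := h i
    rw [Ring.lie_def, ← entry_lax_pow_two_mul u ℓ hℓ] at h1
    have a1 : ¬ (-1 - 1 : ℤ) = 0 := by omega
    have a2 : ¬ (0 : ℤ) ≤ -1 - 1 := by omega
    simp only [neg_add_cancel, if_true, le_refl, neg_add_cancel_right, a1, a2, if_false, zero_add]
    rw [h1, mul_sub, mul_assoc, ← mul_assoc (u i), ← (hκ (u i)).eq, mul_assoc]
  -- Even powers of `L` have no term of degree `-1`, so in degrees `d ≥ 0` the truncation is
  -- invisible and `[L^{2ℓ}, L] = 0` applies.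
  · have h0 : ∀ j, (if 0 ≤ d - 1 then κ * (lax u ^ (2 * ℓ)).entry (d - 1) j else 0)
        = κ * (lax u ^ (2 * ℓ)).entry (d - 1) j := by
      intro j
      split_ifs with h0
      · rfl
      · rw [entry_lax_pow_of_parity u _ (by push_cast; omega), mul_zero]
    have a1 : ¬ d + 1 = 0 := by omega
    have a2 : 0 ≤ d + 1 := by omega
    simp only [h0, a1, a2, if_true, if_false, zero_mul, mul_zero, add_zero, sub_self]
    rw [mul_assoc, ← mul_add, ← mul_assoc (u i), ← (hκ (u i)).eq, mul_assoc,
      ← mul_add, hcomm, sub_self]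

theorem const_lie_eq_zero {ℓ m : ℕ} (hℓ : 1 ≤ ℓ) (hm : 1 ≤ m) {κ κ' H H' : A}
    (hκ : ∀ a, Commute κ a) (hκ' : ∀ a, Commute κ' a)
    (h : ∀ i, ⁅H, u i⁆ = κ * ((lax u ^ (2 * ℓ - 1)).entry (-1) (i + 1) * u i
        - u i * (lax u ^ (2 * ℓ - 1)).entry (-1) (i - 1)))
    (h' : ∀ i, ⁅H', u i⁆ = κ' * ((lax u ^ (2 * m - 1)).entry (-1) (i + 1) * u i
        - u i * (lax u ^ (2 * m - 1)).entry (-1) (i - 1))) (i : ℤ) :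
    ⁅⁅H, H'⁆, u i⁆ = 0 := by
  have h1 := const_lie_lax u hℓ hκ h
  have h2 := const_lie_lax u hm hκ' h'
  -- The Lax form says that `const a - x` commutes with `L`, hence also with central multiples of
  -- powers of `L`.
  have key : ∀ {a κ : A} {x : DiffOp A} {n : ℕ}, (∀ a, Commute κ a) →
      ⁅const a, lax u⁆ = ⁅x, lax u⁆ → ⁅const a, const κ * lax u ^ n⁆ = ⁅x, const κ * lax u ^ n⁆ := by
    intro a κ x n hκ hx
    have hc : Commute (const a - x) (lax u) := by
      have h3 : ⁅const a - x, lax u⁆ = 0 := by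
        rw [Ring.lie_def, sub_mul, mul_sub]
        rw [Ring.lie_def, Ring.lie_def] at hx
        rw [sub_sub_sub_comm, hx, sub_self]
      exact sub_eq_zero.1 h3
    have hc2 : Commute (const a - x) (const κ * lax u ^ n) :=
      ((commute_const hκ _).symm).mul_right (hc.pow_right n)
    have h3 := sub_eq_zero.2 hc2.eq
    rw [sub_mul, mul_sub, sub_sub_sub_comm] at h3
    exact sub_eq_zero.1 h3
  have hx : Commute (const κ * lax u ^ (2 * ℓ)) (const κ' * lax u ^ (2 * m)) :=
    (commute_const hκ _).mul_left
      (((commute_const hκ' _).symm).mul_right ((Commute.refl (lax u)).pow_pow _ _))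
  have h3 := lie_lie_eq_zero_of_lax nonnegPart nonnegPart_mul_nonnegPart
    nonnegPart_negPart_mul_negPart (nonnegPart_const_lie H) (nonnegPart_const_lie H') hx h1 h2
    (key hκ' h1) (key hκ h2)
  rw [← const_lie] at h3
  have h4 := congrArg (fun f => entry f (-1) i) h3
  simpa [Ring.lie_def, entry_mul_lax, entry_lax_mul, entry_const] using h4

end DiffOp

end ZeroCurvature

/-! ### The Heisenberg form -/

section Heisenberg

/-- Both neighbours of `n` enter through `hamWeight_mul_level`; the products `ω^{a_{n-1}+a_{n+1}}`
cancel, leaving the commutator. The map `f` covers both the indeterminate and a complex value of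
`ω`. -/
theorem lie_gen {R : Type*} [CommRing R] (f : ℤ[X] →+* R) {ℓ : ℕ} (hℓ : 1 ≤ ℓ)
    (H : QSeries (f X)) (hH : ∀ a, H.coeff a = f (hamWeight ℓ a)) (n : ℤ) :
    ⁅H, QSeries.gen (f X) n⁆ = (1 - f X ^ ℓ) •
      ((DiffOp.lax (QSeries.gen (f X)) ^ (2 * ℓ - 1)).entry (-1) (n + 1) * QSeries.gen (f X) n
        - QSeries.gen (f X) n
          * (DiffOp.lax (QSeries.gen (f X)) ^ (2 * ℓ - 1)).entry (-1) (n - 1)) := by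
  have key : ∀ (a : ℤ →₀ ℕ) (k : ℤ), f (hamWeight ℓ a) * (f X ^ a k - 1) = (f X ^ ℓ - 1) *
      ((DiffOp.lax (QSeries.gen (f X)) ^ (2 * ℓ - 1)).entry (-1) k).coeff a := by
    intro a k
    have h := congrArg f (hamWeight_mul_level hℓ a k)
    rw [coeff_entry_lax_pow_neg_one _ hℓ]
    simp only [map_mul, map_sub, map_pow, map_one, apply_ite f, map_zero, map_walkWeight] at h
    exact h
  ext c
  rw [Ring.lie_def, QSeries.coeff_sub, QSeries.coeff_smul, QSeries.coeff_sub,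
    QSeries.coeff_mul_gen, QSeries.coeff_gen_mul, QSeries.coeff_mul_gen, QSeries.coeff_gen_mul]
  by_cases hc : c n = 0
  · simp [hc]
  · simp only [if_neg hc, hH]
    have h1 := key (c - Finsupp.single n 1) (n + 1)
    have h2 := key (c - Finsupp.single n 1) (n - 1)
    have e : ∀ k, k ≠ n → (c - Finsupp.single n 1 : ℤ →₀ ℕ) k = c k := by
      intro k hk
      simp [Ne.symm hk]
    rw [e _ (by omega)] at h1 h2
    linear_combination f X ^ c (n + 1) * h2 - f X ^ c (n - 1) * h1

theorem shift_u {R : Type*} [CommRing R] (n m : ℤ) : shift n (u R m) = u R (m + n) := by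
  simp [shift, u]

theorem shift_shift {R : Type*} [CommRing R] (n m : ℤ) (x : FreeAlgebra R ℤ) :
    shift n (shift m x) = shift (m + n) x := by
  have h : (shift n).comp (shift m) = shift (R := R) (m + n) := by
    apply FreeAlgebra.hom_ext
    funext k
    have h1 := shift_u (R := R) m k
    have h2 := shift_u (R := R) (m + n) k
    rw [u] at h1 h2
    simp only [Function.comp_apply, AlgHom.coe_comp, h1, h2, shift_u, add_assoc]
  exact congrArg (fun f => f x) h

theorem freeToSeries_gen {R : Type*} [CommRing R] (ω : R) (n : ℤ) :
    freeToSeries ω (u R n) = QSeries.gen ω n := freeToSeries_u ω n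

/-- A derivation of the free algebra is inner in the algebra of series if it is so on the
generators. -/
theorem freeToSeries_evolDer_eq_lie {R : Type*} [CommRing R] (ω c : R) (a₀ : FreeAlgebra R ℤ)
    (H : QSeries ω) (h : ∀ n, freeToSeries ω (shift n a₀) = c • ⁅H, QSeries.gen ω n⁆)
    (a : FreeAlgebra R ℤ) :
    freeToSeries ω (evolDer a₀ a) = c • ⁅H, freeToSeries ω a⁆ := by
  induction a using FreeAlgebra.induction with
  | grade0 r =>
    have h1 : evolDer a₀ (algebraMap R _ r) = 0 := by
      simp [evolDer, TrivSqZeroExt.algebraMap_eq_inl']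
    rw [h1, map_zero, AlgHom.commutes, Ring.lie_def, Algebra.commutes, sub_self, smul_zero]
  | grade1 n =>
    change freeToSeries ω (evolDer a₀ (u R n)) = c • ⁅H, freeToSeries ω (u R n)⁆
    rw [evolDer_u, h, freeToSeries_gen]
  | mul a b ha hb =>
    rw [evolDer_mul, map_add, map_mul, map_mul, ha, hb, map_mul, smul_mul_assoc, mul_smul_comm,
      ← smul_add]
    congr 1
    simp only [Ring.lie_def]
    noncomm_ring
  | add a b ha hb =>
    rw [map_add, map_add, ha, hb, map_add, ← smul_add]
    congr 1
    simp only [Ring.lie_def]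
    noncomm_ring

/-- With `Q = q^ℓ`, one has `1 - Q² = -Q (Q - Q⁻¹) = -2i Q sin(ℓħ/2)`. -/
theorem exp_pow_half (ħ : ℝ) (ℓ : ℕ) (h : Real.sin ((ℓ : ℝ) * ħ / 2) ≠ 0) :
    Complex.I / ((2 * Real.sin ((ℓ : ℝ) * ħ / 2) : ℝ) : ℂ)
      * (1 - Complex.exp (Complex.I * (ħ : ℂ)) ^ ℓ)
      = Complex.exp (Complex.I * ((ħ : ℂ) / 2)) ^ ℓ := by
  have hne : ((2 * Real.sin ((ℓ : ℝ) * ħ / 2) : ℝ) : ℂ) ≠ 0 := by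
    rw [Complex.ofReal_ne_zero]
    exact mul_ne_zero two_ne_zero h
  rw [div_mul_eq_mul_div, div_eq_iff hne]
  set Q := Complex.exp (Complex.I * ((ħ : ℂ) / 2)) ^ ℓ with hQ
  have h1 : Complex.exp (Complex.I * (ħ : ℂ)) ^ ℓ = Q * Q := by
    rw [hQ, ← mul_pow, ← Complex.exp_add]
    congr 2
    ring
  have h2 : Q = Complex.exp ((ℓ : ℂ) * ħ / 2 * Complex.I) := by
    rw [hQ, ← Complex.exp_nat_mul]
    congr 1
    ring
  have h3 : Q * Complex.exp (-((ℓ : ℂ) * ħ / 2) * Complex.I) = 1 := by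
    rw [h2, ← Complex.exp_add]
    simp
  push_cast
  rw [Complex.two_sin, ← h2, h1]
  linear_combination -Complex.I * h3

theorem volterraFlow_heisenberg (ħ : ℝ) {ω q : ℂ} (hω : ω = Complex.exp (Complex.I * (ħ : ℂ)))
    (hq : q = Complex.exp (Complex.I * ((ħ : ℂ) / 2))) {ℓ : ℕ} (hℓ : 1 ≤ ℓ)
    (hsin : Real.sin ((ℓ : ℝ) * ħ / 2) ≠ 0) (a : FreeAlgebra ℂ ℤ) :
    freeToSeries ω (volterraFlow q ℓ a)
      = (Complex.I / ((2 * Real.sin ((ℓ : ℝ) * ħ / 2) : ℝ) : ℂ)) •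
        ⁅hamiltonian ω ℓ, freeToSeries ω a⁆ := by
  refine freeToSeries_evolDer_eq_lie _ _ _ _ (fun n => ?_) a
  have hX : (aeval ω : ℤ[X] →ₐ[ℤ] ℂ).toRingHom X = ω := aeval_X ω
  have hlie := lie_gen (aeval ω : ℤ[X] →ₐ[ℤ] ℂ).toRingHom hℓ
  rw [hX] at hlie
  rw [hlie (hamiltonian ω ℓ) (coeff_hamiltonian ω hℓ) n, smul_smul]
  have hc := exp_pow_half ħ ℓ hsin
  rw [← hω, ← hq] at hc
  rw [hc, map_smul, map_smul, map_sub, map_sub, map_mul, map_mul, map_mul, map_mul, shift_shift,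
    shift_shift, shift_u, zero_add, freeToSeries_gen, freeToSeries_shift_Xpoly _ hℓ,
    freeToSeries_shift_Xpoly _ hℓ, add_comm 1 n, neg_add_eq_sub]

end Heisenberg

/-! ### Hermiticity and commutativity of the Hamiltonians -/

section Commutativity

theorem dagger_hamiltonian {ω : ℂ} (hω : ω * (starRingEnd ℂ) ω = 1) {ℓ : ℕ} (hℓ : 1 ≤ ℓ) :
    dagger (hamiltonian ω ℓ) = hamiltonian ω ℓ := by
  ext a
  change ω ^ cocycle a a * (starRingEnd ℂ) ((hamiltonian ω ℓ).coeff a) = _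
  rw [coeff_hamiltonian ω hℓ]
  by_cases h : ∃ α ∈ indexSet ℓ, ∃ n : ℤ, wt (fun j => α j + n) = a
  · obtain ⟨α, hα, n, rfl⟩ := h
    rw [hamWeight_wt hℓ hα, cocycle_wt_add]
    exact (palindromic_hamCoeff hℓ hα).conj_aeval hω
  · rw [hamWeight, dif_neg h]
    simp

/-- The Hamiltonian over `ℤ[ω]`, with `ω` an indeterminate. -/
def genericHamiltonian (ℓ : ℕ) : QSeries (X : ℤ[X]) := ⟨hamWeight ℓ⟩

/-- For indeterminate `ω` only the constants commute with all generators. -/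
theorem coeff_eq_zero_of_commute_gen {C : QSeries (X : ℤ[X])}
    (hC : ∀ n, ⁅C, QSeries.gen (X : ℤ[X]) n⁆ = 0) {a : ℤ →₀ ℕ} (ha : a ≠ 0) : C.coeff a = 0 := by
  by_contra hne
  have hpow : ∀ n, a (n - 1) = a (n + 1) := by
    intro n
    have h := congrArg (fun f => QSeries.coeff f (a + Finsupp.single n 1)) (hC n)
    simp only [Ring.lie_def, QSeries.coeff_sub, QSeries.coeff_mul_gen, QSeries.coeff_gen_mul,
      QSeries.coeff_zero, add_tsub_cancel_right] at h
    rw [if_neg (by simp), if_neg (by simp), ← sub_mul] at h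
    have h1 := sub_eq_zero.1 ((mul_eq_zero.1 h).resolve_right hne)
    have h2 := congrArg natDegree h1
    rw [natDegree_X_pow, natDegree_X_pow] at h2
    simpa using h2
  have hsupp : a.support.Nonempty := Finsupp.support_nonempty_iff.2 ha
  have h1 := Finsupp.mem_support_iff.1 (a.support.max'_mem hsupp)
  -- The multiplicities would have period two, so the level two above the highest occupied one would
  -- be occupied.
  have h2 := hpow (a.support.max' hsupp + 1)
  rw [add_sub_cancel_right] at h2
  rw [h2] at h1
  have h3 := a.support.le_max' _ (Finsupp.mem_support_iff.2 h1)
  omega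

/-- By zero curvature the commutator commutes with every generator, hence is constant; its constant
term is a commutator in the commutative ring `ℤ[X]`. -/
theorem genericHamiltonian_lie {ℓ m : ℕ} (hℓ : 1 ≤ ℓ) (hm : 1 ≤ m) :
    ⁅genericHamiltonian ℓ, genericHamiltonian m⁆ = 0 := by
  have hlie : ∀ {k : ℕ}, 1 ≤ k → ∀ i, ⁅genericHamiltonian k, QSeries.gen (X : ℤ[X]) i⁆
      = algebraMap ℤ[X] (QSeries (X : ℤ[X])) (1 - X ^ k) *
        ((DiffOp.lax (QSeries.gen (X : ℤ[X])) ^ (2 * k - 1)).entry (-1) (i + 1)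
            * QSeries.gen (X : ℤ[X]) i
          - QSeries.gen (X : ℤ[X]) i
            * (DiffOp.lax (QSeries.gen (X : ℤ[X])) ^ (2 * k - 1)).entry (-1) (i - 1)) := by
    intro k hk i
    rw [← Algebra.smul_def]
    exact lie_gen (RingHom.id ℤ[X]) hk (genericHamiltonian k) (fun _ => rfl) i
  have hcentral := DiffOp.const_lie_eq_zero (QSeries.gen (X : ℤ[X])) hℓ hm
    (fun a => Algebra.commutes _ a) (fun a => Algebra.commutes _ a) (hlie hℓ) (hlie hm)
  ext a
  by_cases ha : a = 0
  · subst ha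
    rw [Ring.lie_def, QSeries.coeff_sub, QSeries.coeff_mul, QSeries.coeff_mul]
    simp [mul_comm]
  · rw [coeff_eq_zero_of_commute_gen hcentral ha, QSeries.coeff_zero]

/-- Coefficients and structure constants are polynomials in `ω`, so the generic identity is
evaluated coefficient by coefficient. -/
theorem hamiltonian_lie (ω : ℂ) {ℓ m : ℕ} (hℓ : 1 ≤ ℓ) (hm : 1 ≤ m) :
    ⁅hamiltonian ω ℓ, hamiltonian ω m⁆ = 0 := by
  ext a
  have h := congrArg (fun f => aeval ω (QSeries.coeff f a)) (genericHamiltonian_lie hℓ hm)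
  simp only [Ring.lie_def, QSeries.coeff_sub, QSeries.coeff_mul, genericHamiltonian, map_sub,
    map_sum, map_mul, map_pow, aeval_X, QSeries.coeff_zero, map_zero] at h
  simp only [Ring.lie_def, QSeries.coeff_sub, QSeries.coeff_mul, coeff_hamiltonian ω hℓ,
    coeff_hamiltonian ω hm, QSeries.coeff_zero]
  exact h

end Commutativity

end Volterra

end

theorem theorem1 (ħ : ℝ) (ω q : ℂ) (hω : ω = Complex.exp (Complex.I * (ħ : ℂ)))
    (hq : q = Complex.exp (Complex.I * ((ħ : ℂ) / 2))) :
    (∀ ℓ : ℕ, 1 ≤ ℓ → ∀ α ∈ Volterra.indexSet ℓ,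
      Volterra.P α = ∏ i ∈ Finset.range ℓ,
          Volterra.gaussBinom
            (Volterra.wt α ((i : ℤ) + 1) + Volterra.wt α (i : ℤ) - 1)
            (Volterra.wt α ((i : ℤ) + 1)) ∧
      Volterra.hamCoeff α * ((Polynomial.X : Polynomial ℤ) ^ (Volterra.wt α 0) - 1)
        = Volterra.P α * ((Polynomial.X : Polynomial ℤ) ^ ℓ - 1)) ∧
    (∀ ℓ : ℕ, 1 ≤ ℓ → Real.sin ((ℓ : ℝ) * ħ / 2) ≠ 0 → ∀ a : FreeAlgebra ℂ ℤ,
      Volterra.toSeries ω (Volterra.proj ω (Volterra.volterraFlow q ℓ a))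
        = (Complex.I / ((2 * Real.sin ((ℓ : ℝ) * ħ / 2) : ℝ) : ℂ)) •
          ⁅Volterra.hamiltonian ω ℓ, Volterra.toSeries ω (Volterra.proj ω a)⁆) ∧
    (∀ ℓ : ℕ, 1 ≤ ℓ →
      Volterra.dagger (Volterra.hamiltonian ω ℓ) = Volterra.hamiltonian ω ℓ) ∧
    (∀ ℓ m : ℕ, 1 ≤ ℓ → 1 ≤ m →
      ⁅Volterra.hamiltonian ω ℓ, Volterra.hamiltonian ω m⁆ = 0) := by
  refine ⟨fun ℓ hℓ α hα => ⟨?_, Volterra.hamCoeff_mul hℓ hα⟩, fun ℓ hℓ hsin a => ?_,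
    fun ℓ hℓ => Volterra.dagger_hamiltonian ?_ hℓ,
    fun ℓ m hℓ hm => Volterra.hamiltonian_lie ω hℓ hm⟩
  · rw [Volterra.P_eq_prod_qBinom hℓ hα]
    exact Finset.prod_congr rfl fun i _ => (Volterra.gaussBinom_eq_qBinom _ _).symm
  · rw [Volterra.toSeries_proj, Volterra.toSeries_proj]
    exact Volterra.volterraFlow_heisenberg ħ hω hq hℓ hsin a
  · rw [hω, ← Complex.exp_conj, ← Complex.exp_add]
    simp
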